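/- Let $K$ be an algebraically closed field of characteristic $p\neq 0,2,3$, and let $E_i: y^2=x^3+A_ix+B_i$ ($i=1,2$) be elliptic curves over $K$. Let $K[\varepsilon]$, $\varepsilon^2=0$, be the dual numbers over $K$, and let $\tilde E_i$ be the curve given by the same equation over $K[\varepsilon]$. The group $\tilde E_i(K[\varepsilon])$, under the chord and tangent law, consists of the affine points $(x,y)\in K[\varepsilon]^2$ on the curve and of the points at infinity $\mathcal O_k=(k\varepsilon:1:0)$, $k\in K$. It contains $E_i(K)$ and is mapped onto it by reduction modulo $\varepsilon$. Let $\phi:E_1\to E_2$ be an isogeny, i.e. a nonzero homomorphism $E_1(K)\to E_2(K)$ given by rational functions of $x,y$ at all but finitely many points. Then: 1. There are unique rational functions $r,s\in K(x)$ with $\phi(x,y)=(r(x),\,y\,s(x))$, and there is a unique $m\in K$ with $t_2\circ\phi=m\,t_1+O(t_1^2)$ at the point at infinity, where $t_i=-x_i/y_i$. They satisfy $m\,s=r'$ in $K(x)$. 2. There is a unique map $\tilde\phi:\tilde E_1(K[\varepsilon])\to\tilde E_2(K[\varepsilon])$ such that - $\tilde\phi(\mathcal O_k)=\mathcal O_{mk}$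 for all $k\in K$; - if $\tilde P=(x,y)$ is an affine point whose reduction $P$ is not in $\ker\phi$, then the denominators of $r$ and $s$ (in lowest terms) are invertible at $x$ and $\tilde\phi(\tilde P)=(r(x),\,y\,s(x))$; - if $\tilde P$ is an affine point whose reduction $P$ is in $\ker\phi$, then for every $T\in E_1(K)\setminus\ker\phi$ the point $\tilde P+T$ is affine, the denominators of $r$ and $s$ are invertible at its $x$-coordinate, and $\tilde\phi(\tilde P)=\phi(\tilde P+T)+\phi(-T)$, where $\phi(\tilde P+T)$ is the value of $(r(x),\,y\,s(x))$ at $\tilde P+T$. 3. The map $\tilde\phi$ extends $\phi$ and is a group homomorphism: $\tilde\phi(P)+\tilde\phi(Q)=\tilde\phi(P+Q)$ for all $P,Q\in\tilde E_1(K[\varepsilon])$. -/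

import Mathlib

open Polynomial TrivSqZeroExt
open scoped DualNumber Polynomial.Bivariate

namespace DualEC

section Curves

variable {K : Type*} [Field K]

/-- The Weierstrass curve `y² = x³ + A x + B` over `K`. -/
def curve (A B : K) : WeierstrassCurve.Affine K := ⟨0, 0, 0, A, B⟩

/-- The points of the canonical lift `y² = x³ + A x + B` over the dual numbers `K[ε]`: the affine
points `(x : y : 1)` with `x, y ∈ K[ε]`, and the points at infinity `O_k = (k ε : 1 : 0)`. -/
inductive LiftPoint (A B : K) : Type _
  | affine (x y : K[ε]) (h : y ^ 2 = x ^ 3 + inl A * x + inl B) : LiftPoint A B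
  | inf (k : K) : LiftPoint A B

theorem fst_equation {A B : K} {x y : K[ε]} (h : y ^ 2 = x ^ 3 + inl A * x + inl B) :
    y.fst ^ 2 = x.fst ^ 3 + A * x.fst + B := by
  simpa using congrArg fst h

theorem snd_equation {A B : K} {x y : K[ε]} (h : y ^ 2 = x ^ 3 + inl A * x + inl B) :
    2 * y.fst * y.snd = (3 * x.fst ^ 2 + A) * x.snd := by
  have h' := congrArg snd h
  simp only [pow_succ, pow_zero, one_mul, DualNumber.snd_mul, snd_add, fst_mul, fst_inl,
    snd_inl] at h'
  linear_combination h'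

theorem equation_of {A B : K} {x y : K[ε]} (h₀ : y.fst ^ 2 = x.fst ^ 3 + A * x.fst + B)
    (h₁ : 2 * y.fst * y.snd = (3 * x.fst ^ 2 + A) * x.snd) :
    y ^ 2 = x ^ 3 + inl A * x + inl B := by
  ext
  · simpa using h₀
  · simp only [pow_succ, pow_zero, one_mul, DualNumber.snd_mul, snd_add, fst_mul, fst_inl,
      snd_inl]
    linear_combination h₁

theorem mul_inv_self {u : K[ε]} (hu : u.fst ≠ 0) : u * u⁻¹ = 1 :=
  TrivSqZeroExt.mul_inv_cancel hu

/-- The slope of the line through two affine points of the lift, that is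
`(y₁ - y₂) / (x₁ - x₂) = (x₁² + x₁ x₂ + x₂² + A) / (y₁ + y₂)`, computed by whichever of the two
fractions has an invertible denominator. -/
def slope (A : K) [DecidableEq K] (x₁ y₁ x₂ y₂ : K[ε]) : K[ε] :=
  if x₁.fst ≠ x₂.fst then (y₁ - y₂) * (x₁ - x₂)⁻¹
  else (x₁ ^ 2 + x₁ * x₂ + x₂ ^ 2 + inl A) * (y₁ + y₂)⁻¹

/-- If the affine points `P₁, P₂` have opposite reductions, the line through them is
`x - x₁ = c (y - y₁)` with `c = (x₁ - x₂) / (y₁ - y₂) = (y₁ + y₂) / (x₁² + x₁ x₂ + x₂² + A)`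
in `K ε`, it meets the curve again at infinity in `(c : 1 : 0)`, and so `P₁ + P₂ = (-c : 1 : 0)`. -/
def infSum (A : K) [DecidableEq K] (x₁ y₁ x₂ y₂ : K[ε]) : K :=
  if y₁.fst ≠ y₂.fst then (-((x₁ - x₂) * (y₁ - y₂)⁻¹)).snd
  else (-((y₁ + y₂) * (x₁ ^ 2 + x₁ * x₂ + x₂ ^ 2 + inl A)⁻¹)).snd

theorem slope_rel {A B : K} [DecidableEq K] {x₁ y₁ x₂ y₂ : K[ε]}
    (h₁ : y₁ ^ 2 = x₁ ^ 3 + inl A * x₁ + inl B) (h₂ : y₂ ^ 2 = x₂ ^ 3 + inl A * x₂ + inl B)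
    (h : ¬(x₁.fst = x₂.fst ∧ y₁.fst = -y₂.fst)) :
    slope A x₁ y₁ x₂ y₂ * (x₁ - x₂) = y₁ - y₂ ∧
    slope A x₁ y₁ x₂ y₂ * (y₁ + y₂) = x₁ ^ 2 + x₁ * x₂ + x₂ ^ 2 + inl A := by
  unfold slope
  split_ifs with hx
  · have hu : (x₁ - x₂).fst ≠ 0 := by simpa [sub_eq_zero] using hx
    have hi := mul_inv_self hu
    generalize (x₁ - x₂)⁻¹ = u at *
    constructor
    · linear_combination (y₁ - y₂) * hi
    · linear_combination u * (h₁ - h₂) + (x₁ ^ 2 + x₁ * x₂ + x₂ ^ 2 + inl A) * hi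
  · have hx' : x₁.fst = x₂.fst := not_not.mp hx
    have hu : (y₁ + y₂).fst ≠ 0 := fun h0 => h ⟨hx', eq_neg_of_add_eq_zero_left (by simpa using h0)⟩
    have hi := mul_inv_self hu
    generalize (y₁ + y₂)⁻¹ = u at *
    constructor
    · linear_combination u * (h₂ - h₁) + (y₁ - y₂) * hi
    · linear_combination (x₁ ^ 2 + x₁ * x₂ + x₂ ^ 2 + inl A) * hi

theorem chord_equation {a b x₁ y₁ x₂ y₂ l : K[ε]} (h₁ : y₁ ^ 2 = x₁ ^ 3 + a * x₁ + b)
    (hl : l * (x₁ - x₂) = y₁ - y₂) (hl' : l * (y₁ + y₂) = x₁ ^ 2 + x₁ * x₂ + x₂ ^ 2 + a) :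
    (-(l * (l ^ 2 - x₁ - x₂ - x₁) + y₁)) ^ 2 =
      (l ^ 2 - x₁ - x₂) ^ 3 + a * (l ^ 2 - x₁ - x₂) + b := by
  linear_combination h₁ + (l ^ 2 - x₁ - x₂ - x₁) * hl' - (l ^ 2 - x₁ - x₂ - x₁) * l * hl

theorem translate_equation {A B : K} {x y : K[ε]} (k : K)
    (h : y ^ 2 = x ^ 3 + inl A * x + inl B) :
    (y - (3 * x ^ 2 + inl A) * inr k) ^ 2 =
      (x - 2 * y * inr k) ^ 3 + inl A * (x - 2 * y * inr k) + inl B := by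
  have hk : (inr k * inr k : K[ε]) = 0 := TrivSqZeroExt.inr_mul_inr _ _ _
  linear_combination h + ((3 * x ^ 2 + inl A) ^ 2 - 12 * x * y ^ 2 + 8 * y ^ 3 * inr k) * hk

/-- The chord and tangent addition on the lift: `P₁ + P₂` is the negative of the third point of
intersection with the curve of the line through `P₁` and `P₂`.
* The line through `O_k` and `O_l` is the line at infinity, which meets the curve again in
  `O_{-(k+l)}`.
* The line through `(x, y)` and `O_k` is `X - x = k ε (Y - y)`, which meets the curve again in
  `(x - 2 y k ε, -(y - (3 x² + A) k ε))`.
* The line through two affine points is described at `slope` and `infSum`. -/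
def LiftPoint.add {A B : K} [DecidableEq K] : LiftPoint A B → LiftPoint A B → LiftPoint A B
  | .inf k, .inf l => .inf (k + l)
  | .inf k, .affine x y h =>
      .affine (x - 2 * y * inr k) (y - (3 * x ^ 2 + inl A) * inr k) (translate_equation k h)
  | .affine x y h, .inf k =>
      .affine (x - 2 * y * inr k) (y - (3 * x ^ 2 + inl A) * inr k) (translate_equation k h)
  | .affine x₁ y₁ h₁, .affine x₂ y₂ h₂ =>
      if h : x₁.fst = x₂.fst ∧ y₁.fst = -y₂.fst then .inf (infSum A x₁ y₁ x₂ y₂)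
      else
        .affine (slope A x₁ y₁ x₂ y₂ ^ 2 - x₁ - x₂)
          (-(slope A x₁ y₁ x₂ y₂ * (slope A x₁ y₁ x₂ y₂ ^ 2 - x₁ - x₂ - x₁) + y₁))
          (chord_equation h₁ (slope_rel h₁ h₂ h).1 (slope_rel h₁ h₂ h).2)

/-- Negation: `-(x, y) = (x, -y)` and `-O_k = O_{-k}`. -/
def LiftPoint.neg {A B : K} : LiftPoint A B → LiftPoint A B
  | .inf k => .inf (-k)
  | .affine x y h => .affine x (-y) (by rw [neg_sq]; exact h)

instance {A B : K} : Zero (LiftPoint A B) := ⟨.inf 0⟩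
instance {A B : K} [DecidableEq K] : Add (LiftPoint A B) := ⟨LiftPoint.add⟩
instance {A B : K} : Neg (LiftPoint A B) := ⟨LiftPoint.neg⟩

theorem point_equation {A B x y : K} (h : (curve A B).Nonsingular x y) :
    y ^ 2 = x ^ 3 + A * x + B := by
  have := ((curve A B).equation_iff x y).mp h.1
  simpa [curve] using this

/-- The inclusion of the points of the curve over `K` among the points of the lift. -/
def ofCurve {A B : K} : (curve A B).Point → LiftPoint A B
  | .zero => .inf 0
  | .some x y h => .affine (inl x) (inl y) (equation_of (by simpa using point_equation h) (by simp))

/-- The reduction modulo `ε`. -/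
def reduction {A B : K} [(curve A B).IsElliptic] : LiftPoint A B → (curve A B).Point
  | .inf _ => .zero
  | .affine x y h => .some x.fst y.fst <| (curve A B).equation_iff_nonsingular.mp <|
      ((curve A B).equation_iff _ _).mpr (by simpa [curve] using fst_equation h)

end Curves

section GroupLaw

variable {K : Type*} [Field K] {A B : K}

theorem two_eq : (2 : K[ε]) = inl 2 := rfl

theorem three_eq : (3 : K[ε]) = inl 3 := rfl

theorem affine_ext {x y x' y' : K[ε]} {h : y ^ 2 = x ^ 3 + inl A * x + inl B}
    {h' : y' ^ 2 = x' ^ 3 + inl A * x' + inl B} (hx : x = x') (hy : y = y') :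
    LiftPoint.affine x y h = .affine x' y' h' := by
  subst hx hy; rfl

theorem disc_ne [(curve A B).IsElliptic] : (2 : K) ≠ 0 ∧ 4 * A ^ 3 + 27 * B ^ 2 ≠ 0 := by
  have h : (curve A B).Δ ≠ 0 := (curve A B).isUnit_Δ.ne_zero
  have e : (curve A B).Δ = -2 ^ 4 * (4 * A ^ 3 + 27 * B ^ 2) := by
    simp [curve, WeierstrassCurve.Δ, WeierstrassCurve.b₂, WeierstrassCurve.b₄,
      WeierstrassCurve.b₆, WeierstrassCurve.b₈]; ring
  constructor <;> intro h0 <;> exact h (by rw [e, h0]; ring)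

theorem deriv_ne [(curve A B).IsElliptic] {x : K} (h : x ^ 3 + A * x + B = 0) :
    3 * x ^ 2 + A ≠ 0 := by
  intro h'
  refine (disc_ne (A := A) (B := B)).2 ?_
  linear_combination 27 * (B - x ^ 3 - A * x) * h +
    (9 * x ^ 4 + 15 * A * x ^ 2 + 4 * A ^ 2) * h'

variable [DecidableEq K]

/-- The points of the lift are the `P + O_k` with `P` a point over `K`. -/
def sumPoint (P : (curve A B).Point) (k : K) : LiftPoint A B := ofCurve P + .inf k

theorem sumPoint_zero (k : K) : sumPoint (0 : (curve A B).Point) k = .inf k := by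
  change LiftPoint.inf (0 + k) = _
  rw [zero_add]

theorem sumPoint_some {x y : K} (h : (curve A B).Nonsingular x y) (k : K) :
    sumPoint (.some x y h) k = .affine (inl x - 2 * inl y * inr k)
      (inl y - (3 * inl x ^ 2 + inl A) * inr k)
      (translate_equation k (equation_of (by simpa using point_equation h) (by simp))) := rfl

theorem add_sumPoint_inf (P : (curve A B).Point) (k l : K) :
    sumPoint P k + .inf l = sumPoint P (k + l) := by
  rcases P with _ | ⟨x, y, h⟩
  · change sumPoint 0 k + .inf l = sumPoint 0 (k + l)
    rw [sumPoint_zero, sumPoint_zero]; rfl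
  · rw [sumPoint_some, sumPoint_some]
    change LiftPoint.affine _ _ _ = _
    refine affine_ext ?_ ?_ <;> ext <;> simp [pow_succ] <;> ring

theorem add_affine_of_opp {x₁ y₁ x₂ y₂ : K[ε]} {h₁ : y₁ ^ 2 = x₁ ^ 3 + inl A * x₁ + inl B}
    {h₂ : y₂ ^ 2 = x₂ ^ 3 + inl A * x₂ + inl B} (h : x₁.fst = x₂.fst ∧ y₁.fst = -y₂.fst) :
    LiftPoint.affine x₁ y₁ h₁ + .affine x₂ y₂ h₂ = .inf (infSum A x₁ y₁ x₂ y₂) :=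
  dif_pos h

theorem add_affine_of_not_opp {x₁ y₁ x₂ y₂ : K[ε]} {h₁ : y₁ ^ 2 = x₁ ^ 3 + inl A * x₁ + inl B}
    {h₂ : y₂ ^ 2 = x₂ ^ 3 + inl A * x₂ + inl B} (h : ¬(x₁.fst = x₂.fst ∧ y₁.fst = -y₂.fst)) :
    LiftPoint.affine x₁ y₁ h₁ + .affine x₂ y₂ h₂ =
      .affine (slope A x₁ y₁ x₂ y₂ ^ 2 - x₁ - x₂)
        (-(slope A x₁ y₁ x₂ y₂ * (slope A x₁ y₁ x₂ y₂ ^ 2 - x₁ - x₂ - x₁) + y₁))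
        (chord_equation h₁ (slope_rel h₁ h₂ h).1 (slope_rel h₁ h₂ h).2) :=
  dif_neg h

theorem slope_eq {x₁ y₁ x₂ y₂ l : K[ε]} (h : ¬(x₁.fst = x₂.fst ∧ y₁.fst = -y₂.fst))
    (hl : l * (x₁ - x₂) = y₁ - y₂) (hl' : l * (y₁ + y₂) = x₁ ^ 2 + x₁ * x₂ + x₂ ^ 2 + inl A) :
    slope A x₁ y₁ x₂ y₂ = l := by
  unfold slope
  split_ifs with hx
  · have hi := mul_inv_self (u := x₁ - x₂) (by simpa [sub_eq_zero] using hx)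
    linear_combination -(x₁ - x₂)⁻¹ * hl + l * hi
  · have hi := mul_inv_self (u := y₁ + y₂)
      fun h0 => h ⟨not_not.mp hx, eq_neg_of_add_eq_zero_left (by simpa using h0)⟩
    linear_combination -(y₁ + y₂)⁻¹ * hl' + l * hi

theorem add_comm_lift (P Q : LiftPoint A B) : P + Q = Q + P := by
  rcases P with ⟨x₁, y₁, h₁⟩ | k <;> rcases Q with ⟨x₂, y₂, h₂⟩ | l
  · by_cases h : x₁.fst = x₂.fst ∧ y₁.fst = -y₂.fst
    · have h' : x₂.fst = x₁.fst ∧ y₂.fst = -y₁.fst := ⟨h.1.symm, by rw [h.2, neg_neg]⟩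
      rw [add_affine_of_opp h, add_affine_of_opp h']
      congr 1
      unfold infSum
      have e₁ : x₂ - x₁ = -(x₁ - x₂) := by ring
      have e₂ : y₂ - y₁ = -(y₁ - y₂) := by ring
      have e₃ : x₂ ^ 2 + x₂ * x₁ + x₁ ^ 2 + inl A = x₁ ^ 2 + x₁ * x₂ + x₂ ^ 2 + inl A := by ring
      rw [e₁, e₂, e₃, TrivSqZeroExt.inv_neg, neg_mul_neg, add_comm y₂]
      simp only [ne_comm]
    · have h' : ¬(x₂.fst = x₁.fst ∧ y₂.fst = -y₁.fst) :=
        fun h' => h ⟨h'.1.symm, by rw [h'.2, neg_neg]⟩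
      have r := slope_rel h₁ h₂ h
      have e : slope A x₂ y₂ x₁ y₁ = slope A x₁ y₁ x₂ y₂ :=
        slope_eq h' (by linear_combination -r.1) (by linear_combination r.2)
      rw [add_affine_of_not_opp h, add_affine_of_not_opp h']
      refine affine_ext ?_ ?_ <;> rw [e]
      · ring
      · linear_combination r.1
  · rfl
  · rfl
  · exact congrArg LiftPoint.inf (add_comm k l)

theorem sumPoint_surjective [(curve A B).IsElliptic] (P : LiftPoint A B) :
    ∃ Q k, P = sumPoint Q k := by
  rcases P with ⟨x, y, h⟩ | k
  · have h0 := fst_equation h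
    have h1 := snd_equation h
    have h2 := (disc_ne (A := A) (B := B)).1
    have hn : (curve A B).Nonsingular x.fst y.fst := (curve A B).equation_iff_nonsingular.mp <|
      ((curve A B).equation_iff _ _).mpr (by simpa [curve] using h0)
    by_cases hy : y.fst = 0
    · have hd := deriv_ne (A := A) (B := B) (x := x.fst) (by rw [← h0, hy]; ring)
      refine ⟨.some _ _ hn, -y.snd / (3 * x.fst ^ 2 + A), ?_⟩
      rw [sumPoint_some]
      have hx : x.snd = 0 := by
        rw [hy] at h1
        simpa [hd] using h1.symm
      refine affine_ext ?_ ?_ <;> ext <;> simp [pow_succ, hx, hy, two_eq, three_eq]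
      field_simp
    · refine ⟨.some _ _ hn, -x.snd / (2 * y.fst), ?_⟩
      rw [sumPoint_some]
      refine affine_ext ?_ ?_ <;> ext <;> simp [pow_succ, two_eq, three_eq]
      · field_simp
      · field_simp
        linear_combination h1
  · exact ⟨0, k, (sumPoint_zero k).symm⟩

theorem sumPoint_add [(curve A B).IsElliptic] (P Q : (curve A B).Point) (k l : K) :
    sumPoint P k + sumPoint Q l = sumPoint (P + Q) (k + l) := by
  rcases P with _ | ⟨x₁, y₁, h₁⟩
  · change sumPoint 0 k + _ = sumPoint (0 + Q) _
    rw [sumPoint_zero, add_comm_lift, add_sumPoint_inf, zero_add, add_comm l]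
  rcases Q with _ | ⟨x₂, y₂, h₂⟩
  · change _ + sumPoint 0 l = sumPoint (_ + 0) _
    rw [sumPoint_zero, add_sumPoint_inf, add_zero]
  have e₁ := point_equation h₁
  have e₂ := point_equation h₂
  have two := (disc_ne (A := A) (B := B)).1
  by_cases hxy : x₁ = x₂ ∧ y₁ = -y₂
  · obtain ⟨rfl, rfl⟩ := hxy
    rw [WeierstrassCurve.Affine.Point.add_of_Y_eq rfl (by simp [WeierstrassCurve.Affine.negY, curve]),
      sumPoint_zero, sumPoint_some h₁, sumPoint_some h₂, add_affine_of_opp (by constructor <;> simp)]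
    congr 1
    unfold infSum
    split_ifs with hy
    · have hy' : y₂ ≠ 0 := by rintro rfl; simp at hy
      have hy2 : -y₂ - y₂ ≠ 0 := by
        rw [show -y₂ - y₂ = -(2 * y₂) by ring]
        exact neg_ne_zero.mpr (mul_ne_zero two hy')
      simp [two_eq, three_eq]
      have hi := mul_inv_cancel₀ hy2
      linear_combination (k + l) * hi
    · have hy' : y₂ = 0 := by
        have h0 : -y₂ = y₂ := by simpa using hy
        have h0' : 2 * y₂ = 0 := by linear_combination -h0
        simpa [two] using h0'
      subst hy'
      have hd := deriv_ne (A := A) (B := B) (x := x₁) (by rw [← e₂]; ring)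
      have hd' : x₁ * x₁ + x₁ * x₁ + x₁ * x₁ + A ≠ 0 := by
        convert hd using 1; ring
      simp [pow_succ, two_eq, three_eq]
      have hi := mul_inv_cancel₀ hd'
      linear_combination (k + l) * hi
  · have hne : ¬(x₁ = x₂ ∧ y₁ = (curve A B).negY x₂ y₂) := by
      simpa [WeierstrassCurve.Affine.negY, curve] using hxy
    rw [WeierstrassCurve.Affine.Point.add_some hne, sumPoint_some h₁, sumPoint_some h₂,
      sumPoint_some, add_affine_of_not_opp (by simpa using hxy)]
    have hL : ∃ L, (curve A B).slope x₁ x₂ y₁ y₂ = L ∧ L * (x₁ - x₂) = y₁ - y₂ ∧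
        L * (y₁ + y₂) = x₁ ^ 2 + x₁ * x₂ + x₂ ^ 2 + A := by
      refine ⟨_, rfl, ?_⟩
      by_cases hx : x₁ = x₂
      · subst hx
        have hy : y₁ + y₂ ≠ 0 := fun h0 => hxy ⟨rfl, eq_neg_of_add_eq_zero_left h0⟩
        have hyy : y₁ = y₂ := by
          have : (y₁ - y₂) * (y₁ + y₂) = 0 := by linear_combination e₁ - e₂
          rcases mul_eq_zero.mp this with h0 | h0
          · exact sub_eq_zero.mp h0
          · exact absurd h0 hy
        subst hyy
        rw [WeierstrassCurve.Affine.slope_of_Y_ne rfl (fun h0 => hne ⟨rfl, h0⟩)]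
        simp [WeierstrassCurve.Affine.negY, curve]
        rw [div_mul_cancel₀ _ hy]
        ring
      · have hx' : x₁ - x₂ ≠ 0 := sub_ne_zero.mpr hx
        rw [WeierstrassCurve.Affine.slope_of_X_ne hx]
        constructor
        · field_simp
        · field_simp
          linear_combination e₁ - e₂
    obtain ⟨L, hLs, r₁, r₂⟩ := hL
    have hs : slope A (inl x₁ - 2 * inl y₁ * inr k) (inl y₁ - (3 * inl x₁ ^ 2 + inl A) * inr k)
        (inl x₂ - 2 * inl y₂ * inr l) (inl y₂ - (3 * inl x₂ ^ 2 + inl A) * inr l) =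
        inl L + inr (k * (L ^ 2 - 2 * x₁ - x₂) + l * (L ^ 2 - x₁ - 2 * x₂)) := by
      refine slope_eq (by simpa using hxy) ?_ ?_
      · ext
        · simpa using r₁
        · simp [pow_succ, two_eq, three_eq]
          linear_combination (k + l) * L * r₁ + (l - k) * r₂
      · ext
        · simpa using r₂
        · simp [pow_succ, two_eq, three_eq]
          linear_combination (k + l) * L * r₂ + (l * (x₁ + 2 * x₂) - k * (2 * x₁ + x₂)) * r₁
    refine affine_ext ?_ ?_
    · rw [hs, hLs]
      ext
      · simp [curve, WeierstrassCurve.Affine.addX]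
      · simp [pow_succ, two_eq, curve, WeierstrassCurve.Affine.addX,
          WeierstrassCurve.Affine.addY, WeierstrassCurve.Affine.negAddY,
          WeierstrassCurve.Affine.negY]
        linear_combination 2 * l * r₁
    · rw [hs, hLs]
      ext
      · simp [curve, WeierstrassCurve.Affine.addX,
          WeierstrassCurve.Affine.addY, WeierstrassCurve.Affine.negAddY,
          WeierstrassCurve.Affine.negY]
      · simp [pow_succ, two_eq, three_eq, curve, WeierstrassCurve.Affine.addX,
          WeierstrassCurve.Affine.addY, WeierstrassCurve.Affine.negAddY,
          WeierstrassCurve.Affine.negY]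
        linear_combination (2 * k * L - l * L) * r₁ - (2 * k + l) * r₂

theorem neg_sumPoint (P : (curve A B).Point) (k : K) : -sumPoint P k = sumPoint (-P) (-k) := by
  rcases P with _ | ⟨x, y, h⟩
  · change -sumPoint 0 k = sumPoint (-0) (-k)
    rw [neg_zero, sumPoint_zero, sumPoint_zero]; rfl
  · rw [sumPoint_some h, WeierstrassCurve.Affine.Point.neg_some, sumPoint_some]
    change LiftPoint.affine _ _ _ = _
    refine affine_ext ?_ ?_ <;> ext <;>
      simp [curve, WeierstrassCurve.Affine.negY, two_eq, three_eq]

/-- The chord and tangent addition makes the points of the lift a commutative group. -/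
instance [(curve A B).IsElliptic] : AddCommGroup (LiftPoint A B) where
  add_assoc P Q R := by
    obtain ⟨P, k, rfl⟩ := sumPoint_surjective P
    obtain ⟨Q, l, rfl⟩ := sumPoint_surjective Q
    obtain ⟨R, j, rfl⟩ := sumPoint_surjective R
    simp only [sumPoint_add, add_assoc]
  zero_add P := by
    obtain ⟨P, k, rfl⟩ := sumPoint_surjective P
    change LiftPoint.inf 0 + _ = _
    rw [← sumPoint_zero, sumPoint_add, zero_add, zero_add]
  add_zero P := by
    obtain ⟨P, k, rfl⟩ := sumPoint_surjective P
    change _ + LiftPoint.inf 0 = _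
    rw [← sumPoint_zero, sumPoint_add, add_zero, add_zero]
  neg_add_cancel P := by
    obtain ⟨P, k, rfl⟩ := sumPoint_surjective P
    rw [neg_sumPoint, sumPoint_add, neg_add_cancel, neg_add_cancel, sumPoint_zero]
    rfl
  add_comm := add_comm_lift
  nsmul := nsmulRec
  zsmul := zsmulRec

end GroupLaw

section Isogenies

variable {K : Type*} [Field K] [DecidableEq K] {A₁ B₁ A₂ B₂ : K}

/-- For all but finitely many points `P` of the first curve, `P = (x, y)` and `φ P = (x', y')` are
affine and `R x y x' y'` holds. -/
def Generically (φ : (curve A₁ B₁).Point →+ (curve A₂ B₂).Point) (R : K → K → K → K → Prop) :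
    Prop :=
  ∀ᶠ P in Filter.cofinite, ∃ x y h x' y' h',
    P = WeierstrassCurve.Affine.Point.some x y h ∧
    φ P = WeierstrassCurve.Affine.Point.some x' y' h' ∧ R x y x' y'

/-- An isogeny, over an algebraically closed field `K`: a nonzero group homomorphism on `K`-points
that is given by rational functions `N₁ / D₁`, `N₂ / D₂` of `x, y` at all but finitely many points.
It is nonzero since almost all of its values are affine. -/
def IsIsogeny (φ : (curve A₁ B₁).Point →+ (curve A₂ B₂).Point) : Prop :=
  ∃ N₁ D₁ N₂ D₂ : K[X][Y], Generically φ fun x y x' y' =>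
    D₁.evalEval x y ≠ 0 ∧ D₂.evalEval x y ≠ 0 ∧
    x' = N₁.evalEval x y / D₁.evalEval x y ∧ y' = N₂.evalEval x y / D₂.evalEval x y

/-- `φ (x, y) = (r(x), y s(x))` as rational functions. -/
def HasStandardForm (φ : (curve A₁ B₁).Point →+ (curve A₂ B₂).Point) (r s : RatFunc K) : Prop :=
  Generically φ fun x y x' y' =>
    r.denom.eval x ≠ 0 ∧ s.denom.eval x ≠ 0 ∧
    x' = r.eval (RingHom.id K) x ∧ y' = y * s.eval (RingHom.id K) x

/-- `t₂ ∘ φ = m t₁ + O(t₁²)` at the point at infinity, where `tᵢ = -xᵢ / yᵢ`. That is,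
`t₂ ∘ φ = m t₁ + t₁² g` for a rational function `g` that is regular at infinity. In the chart
`(x / y, 1 / y)`, where the point at infinity is the origin, `g = F / G` with `G(0, 0) ≠ 0`. -/
def HasLinearTerm (φ : (curve A₁ B₁).Point →+ (curve A₂ B₂).Point) (m : K) : Prop :=
  ∃ F G : K[X][Y], G.evalEval 0 0 ≠ 0 ∧ Generically φ fun x y x' y' =>
    y ≠ 0 ∧ y' ≠ 0 ∧ G.evalEval (x / y) (1 / y) ≠ 0 ∧
    -x' / y' = m * (-x / y) +
      (-x / y) ^ 2 * (F.evalEval (x / y) (1 / y) / G.evalEval (x / y) (1 / y))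

/-- The value of a rational function at a dual number; meaningful if the value of the denominator is
invertible. -/
noncomputable def ratEval (r : RatFunc K) (x : K[ε]) : K[ε] :=
  aeval x r.num * (aeval x r.denom)⁻¹

/-- The derivative of a rational function. -/
noncomputable def ratDeriv (r : RatFunc K) : RatFunc K :=
  algebraMap K[X] (RatFunc K) (derivative r.num * r.denom - r.num * derivative r.denom) /
    algebraMap K[X] (RatFunc K) (r.denom ^ 2)

/-- The formula `(x, y) ↦ (r(x), y s(x))` can be evaluated at the point `P` of the first lift, which
means that `P` is affine and both denominators are invertible at `P`, and its value is the point `Q`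
of the second lift. -/
def EvaluatesTo (r s : RatFunc K) (P : LiftPoint A₁ B₁) (Q : LiftPoint A₂ B₂) : Prop :=
  ∃ x y h h', P = .affine x y h ∧ IsUnit (aeval x r.denom) ∧ IsUnit (aeval x s.denom) ∧
    Q = .affine (ratEval r x) (y * ratEval s x) h'

/-- `f` is the extension of `φ` to the lifts, where `φ = (r(x), y s(x))` and
`t₂ ∘ φ = m t₁ + O(t₁²)`:
* `O_k` is sent to `O_{m k}`;
* a lift `P` of an affine point outside `ker φ` is sent to the value of `(r(x), y s(x))` at `P`;
* a lift `P` of an affine point in `ker φ` is sent to the value at `P` of `τ_{φ(-T)} ∘ φ ∘ τ_T`,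
  with `τ` for translation, for each `T` outside `ker φ`. -/
structure IsExtension [(curve A₁ B₁).IsElliptic] [(curve A₂ B₂).IsElliptic]
    (φ : (curve A₁ B₁).Point →+ (curve A₂ B₂).Point) (r s : RatFunc K) (m : K)
    (f : LiftPoint A₁ B₁ → LiftPoint A₂ B₂) : Prop where
  map_inf : ∀ k, f (.inf k) = .inf (m * k)
  map_of_not_mem_ker : ∀ P, reduction P ≠ 0 → reduction P ∉ φ.ker → EvaluatesTo r s P (f P)
  map_of_mem_ker : ∀ P, reduction P ≠ 0 → reduction P ∈ φ.ker → ∀ T, T ∉ φ.ker →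
    ∃ Q, EvaluatesTo r s (P + ofCurve T) Q ∧ f P = Q + ofCurve (φ (-T))

end Isogenies

end DualEC

open DualEC

/-!
# Isogenies extend to the dual numbers

Every point of the lift is `P + O_k` with `P` a point over `K`, so an extension of `φ` that is a
homomorphism with `O_k ↦ O_{m k}` can only be `P + O_k ↦ φ P + O_{m k}`, and this map is a
homomorphism. The content of the theorem is that it is given by the formula `(r(x), y s(x))`
wherever the reduction is outside the kernel, and that `m` can be read off at infinity.

*Regularity.* `HasValue` says that a function, known at almost all points of the curve, is a
quotient of two polynomials with invertible denominator at a given point of the lift, and has a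
given value there. Values are unique, since a polynomial that vanishes at infinitely many points of
the curve is divisible by its equation (`vanish_of_frequently`). They are compatible with all
arithmetic, and so with the group law, as long as the chord formula applies
(`HasPointValue.add_point`).

*The formula outside the kernel.* Almost everywhere `φ = τ_{-φ T} ∘ φ ∘ τ_T`, where `τ` denotes
translation. For almost all `T` the translation by `T` moves a given point to one at which
`(r(x), y s(x))` is known to represent `φ`. Therefore `x(φ)` and `y(φ)` have values at every lift of
a point outside the kernel, which makes the denominators of `r` and `s` invertible there, and
these values are related by translation (`HasStandardForm.evaluatesTo_translate`). Hence the value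
at `P + O_k` is `φ P + O_κ` with `κ` independent of `P`. Comparing the coefficients of `ε` gives
`s(x) κ = r'(x) k`, so that `κ = m k` with a constant `m` such that `m s = r'`
(`HasStandardForm.exists_multiplier`). This is the invariance of the differential `dx / y`.

*Infinity.* The function `r` has a pole at infinity: if it were regular, then `x(φ(Q + T))` would be
regular at `Q = -T`, against `φ(Q + T) = φ Q + φ T` (`HasStandardForm.natDegree_lt`). From this,
`m s = r'` and the equation of the second curve, a count of degrees shows that `r / s - m x` is
finite at infinity (`natDegree_linear_term_le`). In the chart `(x / y, 1 / y)` this says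
`t₂ ∘ φ = m t₁ + O(t₁²)`. The coefficient `m` is unique because a polynomial in `x / y` and `1 / y`
that vanishes at almost all points vanishes at infinity (`evalEval_zero_of_eventually`).
-/

namespace DualEC

open Filter

/-! ### Coordinates of points and cofinite sets of points -/

section Points

variable {K : Type*} [Field K] {A B : K}

/-- The `x`-coordinate of a point, with the junk value `0` at infinity. -/
def xCoord : (curve A B).Point → K
  | .zero => 0
  | .some x _ _ => x

/-- The `y`-coordinate of a point, with the junk value `0` at infinity. -/
def yCoord : (curve A B).Point → K
  | .zero => 0
  | .some _ y _ => y

@[simp] theorem xCoord_some {x y : K} (h : (curve A B).Nonsingular x y) :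
    xCoord (.some x y h) = x := rfl

@[simp] theorem yCoord_some {x y : K} (h : (curve A B).Nonsingular x y) :
    yCoord (.some x y h) = y := rfl

theorem exists_some {P : (curve A B).Point} (hP : P ≠ 0) :
    ∃ h : (curve A B).Nonsingular (xCoord P) (yCoord P), P = .some _ _ h := by
  rcases P with _ | ⟨x, y, h⟩
  · exact absurd rfl hP
  · exact ⟨h, rfl⟩

theorem coord_equation {P : (curve A B).Point} (hP : P ≠ 0) :
    yCoord P ^ 2 = xCoord P ^ 3 + A * xCoord P + B := by
  obtain ⟨h, -⟩ := exists_some hP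
  exact point_equation h

theorem nonsingular_of_equation [(curve A B).IsElliptic] {x y : K}
    (h : y ^ 2 = x ^ 3 + A * x + B) : (curve A B).Nonsingular x y :=
  (curve A B).equation_iff_nonsingular.mp <|
    ((curve A B).equation_iff _ _).mpr (by simpa [curve] using h)

theorem point_ext {P Q : (curve A B).Point} (hP : P ≠ 0) (hQ : Q ≠ 0)
    (hx : xCoord P = xCoord Q) (hy : yCoord P = yCoord Q) : P = Q := by
  rcases P with _ | ⟨x, y, h⟩
  · exact absurd rfl hP
  rcases Q with _ | ⟨x', y', h'⟩
  · exact absurd rfl hQ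
  simp only [xCoord_some, yCoord_some] at hx hy
  subst hx hy
  rfl

theorem xCoord_neg (P : (curve A B).Point) : xCoord (-P) = xCoord P := by
  rcases P with _ | ⟨x, y, h⟩ <;> rfl

theorem yCoord_neg (P : (curve A B).Point) : yCoord (-P) = -yCoord P := by
  rcases P with _ | ⟨x, y, h⟩
  · exact neg_zero.symm
  · rw [WeierstrassCurve.Affine.Point.neg_some, yCoord_some, yCoord_some]
    simp [curve, WeierstrassCurve.Affine.negY]

theorem eq_or_eq_neg_of_xCoord_eq {P Q : (curve A B).Point} (hP : P ≠ 0) (hQ : Q ≠ 0)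
    (h : xCoord P = xCoord Q) : P = Q ∨ P = -Q := by
  have e : (yCoord P - yCoord Q) * (yCoord P + yCoord Q) = 0 := by
    have h₁ := coord_equation hP
    have h₂ := coord_equation hQ
    rw [h] at h₁
    linear_combination h₁ - h₂
  rcases mul_eq_zero.mp e with e | e
  · exact .inl (point_ext hP hQ h (sub_eq_zero.mp e))
  · have hQ' : -Q ≠ 0 := by
      rcases Q with _ | ⟨x, y, h'⟩
      · exact absurd rfl hQ
      · exact WeierstrassCurve.Affine.Point.some_ne_zero _
    exact .inr (point_ext hP hQ' (by rw [xCoord_neg, h])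
      (by rw [yCoord_neg, eq_neg_of_add_eq_zero_left e]))

theorem tendsto_xCoord : Tendsto (xCoord : (curve A B).Point → K) cofinite cofinite := by
  refine Tendsto.cofinite_of_finite_preimage_singleton fun a => ?_
  by_cases h : ∃ Q : (curve A B).Point, Q ≠ 0 ∧ xCoord Q = a
  · obtain ⟨Q, hQ, rfl⟩ := h
    refine (Set.toFinite {0, Q, -Q}).subset fun P hP => ?_
    by_cases h0 : P = 0
    · simp [h0]
    · rcases eq_or_eq_neg_of_xCoord_eq h0 hQ hP with rfl | rfl <;> simp
  · refine (Set.finite_singleton 0).subset fun P hP => ?_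
    by_contra h0
    exact h ⟨P, h0, hP⟩

theorem eventually_ne_point (Q : (curve A B).Point) : ∀ᶠ P in cofinite, P ≠ Q :=
  (Set.finite_singleton Q).compl_mem_cofinite

theorem eventually_eval_xCoord_ne {q : K[X]} (hq : q ≠ 0) :
    ∀ᶠ P : (curve A B).Point in cofinite, q.eval (xCoord P) ≠ 0 := by
  classical
  refine tendsto_xCoord.eventually (p := fun x => q.eval x ≠ 0) ?_
  refine (q.roots.toFinset.finite_toSet.subset fun x hx => ?_ : {x | ¬q.eval x ≠ 0}.Finite)
  simpa [hq] using hx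

theorem eventually_yCoord_ne : ∀ᶠ P : (curve A B).Point in cofinite, yCoord P ≠ 0 := by
  have hq : (X ^ 3 + C A * X + C B : K[X]) ≠ 0 :=
    (Monic.ne_zero (by monicity!))
  filter_upwards [eventually_eval_xCoord_ne hq, eventually_ne_point 0] with P h h0 hy
  have := coord_equation h0
  rw [hy] at this
  exact h (by simp only [eval_add, eval_mul, eval_pow, eval_X, eval_C]; rw [← this]; ring)

theorem exists_xCoord [IsAlgClosed K] [(curve A B).IsElliptic] (x : K) :
    ∃ P : (curve A B).Point, P ≠ 0 ∧ xCoord P = x := by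
  obtain ⟨y, hy⟩ := IsAlgClosed.exists_pow_nat_eq (x ^ 3 + A * x + B) two_pos
  exact ⟨.some x y (nonsingular_of_equation hy), WeierstrassCurve.Affine.Point.some_ne_zero _, rfl⟩

instance [IsAlgClosed K] [(curve A B).IsElliptic] : Infinite (curve A B).Point :=
  have : Infinite K := IsAlgClosed.instInfinite
  .of_surjective xCoord fun x => (exists_xCoord x).imp fun _ h => h.2

/-- A polynomial that vanishes at the `x`-coordinates of infinitely many points is zero. -/
theorem eq_zero_of_frequently {q : K[X]}
    (h : ∃ᶠ P : (curve A B).Point in cofinite, q.eval (xCoord P) = 0) : q = 0 := by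
  by_contra hq
  exact h (eventually_eval_xCoord_ne hq)

variable [DecidableEq K]

theorem tendsto_cofinite_of_finite_ker {G H : Type*} [AddGroup G] [AddGroup H] (φ : G →+ H)
    (h : ∀ᶠ g in cofinite, φ g ≠ 0) : Tendsto φ cofinite cofinite := by
  refine Tendsto.cofinite_of_finite_preimage_singleton fun a => ?_
  by_cases ha : ∃ g, φ g = a
  · obtain ⟨g, rfl⟩ := ha
    have hf : {x | ¬φ x ≠ 0}.Finite := h
    refine (hf.preimage (f := fun x => x - g) (sub_left_injective.injOn)).subset fun x hx => ?_
    have hx : φ x = φ g := hx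
    simp [hx]
  · refine Set.finite_empty.subset fun x hx => ha ⟨x, hx⟩

theorem tendsto_add_left (P : (curve A B).Point) :
    Tendsto (fun Q => P + Q) cofinite cofinite := (add_right_injective P).tendsto_cofinite

theorem tendsto_add_self [(curve A B).IsElliptic] :
    Tendsto (fun Q : (curve A B).Point => Q + Q) cofinite cofinite := by
  refine tendsto_cofinite_of_finite_ker
    (AddMonoidHom.id (curve A B).Point + AddMonoidHom.id (curve A B).Point) ?_
  filter_upwards [eventually_yCoord_ne] with P hP h
  have h : P + P = 0 := h
  have h' := congrArg yCoord (eq_neg_of_add_eq_zero_left h)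
  rw [yCoord_neg] at h'
  have : 2 * yCoord P = 0 := by linear_combination h'
  simp [(disc_ne (A := A) (B := B)).1, hP] at this

/-- The chord formula. The tangent formula is never needed, as the points can be chosen generic. -/
theorem add_coord {P Q : (curve A B).Point} (hP : P ≠ 0) (hQ : Q ≠ 0)
    (h : xCoord P ≠ xCoord Q) :
    P + Q ≠ 0 ∧
    xCoord (P + Q) =
      ((yCoord P - yCoord Q) * (xCoord P - xCoord Q)⁻¹) ^ 2 - xCoord P - xCoord Q ∧
    yCoord (P + Q) = -((yCoord P - yCoord Q) * (xCoord P - xCoord Q)⁻¹ *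
      (xCoord (P + Q) - xCoord P) + yCoord P) := by
  rcases P with _ | ⟨x₁, y₁, h₁⟩
  · exact absurd rfl hP
  rcases Q with _ | ⟨x₂, y₂, h₂⟩
  · exact absurd rfl hQ
  simp only [xCoord_some] at h
  rw [WeierstrassCurve.Affine.Point.add_some (fun h' => h h'.1)]
  refine ⟨WeierstrassCurve.Affine.Point.some_ne_zero _, ?_, ?_⟩
  · rw [xCoord_some, xCoord_some, xCoord_some, yCoord_some, yCoord_some,
      WeierstrassCurve.Affine.slope_of_X_ne h]
    simp [WeierstrassCurve.Affine.addX, curve, div_eq_mul_inv]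
  · rw [xCoord_some, xCoord_some, xCoord_some, yCoord_some, yCoord_some, yCoord_some,
      WeierstrassCurve.Affine.slope_of_X_ne h]
    simp [WeierstrassCurve.Affine.addX, WeierstrassCurve.Affine.addY,
      WeierstrassCurve.Affine.negAddY, WeierstrassCurve.Affine.negY, curve, div_eq_mul_inv]

end Points

/-! ### Polynomials that vanish on the curve -/

section Vanishing

variable {K : Type*} [Field K] {A B : K}

/-- Modulo the equation of the curve, a polynomial in `x` and `y` is of the form `a(x) + b(x) y`. -/
theorem exists_add_mul_y (A B : K) (H : K[X][Y]) : ∃ a b : K[X],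
    (∀ x y : K, y ^ 2 = x ^ 3 + A * x + B → H.evalEval x y = a.eval x + b.eval x * y) ∧
    ∀ x y : K[ε], y ^ 2 = x ^ 3 + inl A * x + inl B →
      aevalAeval x y H = aeval x a + aeval x b * y := by
  induction H using Polynomial.induction_on' with
  | add p q hp hq =>
    obtain ⟨a, b, h₁, h₂⟩ := hp
    obtain ⟨a', b', h₁', h₂'⟩ := hq
    refine ⟨a + a', b + b', fun x y h => ?_, fun x y h => ?_⟩
    · rw [evalEval_add, h₁ x y h, h₁' x y h, eval_add, eval_add]; ring
    · rw [map_add, h₂ x y h, h₂' x y h, map_add, map_add]; ring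
  | monomial n q =>
    induction n with
    | zero =>
      refine ⟨q, 0, fun x y _ => ?_, fun x y _ => ?_⟩
      · simp [evalEval]
      · simp
    | succ n ih =>
      obtain ⟨a, b, h₁, h₂⟩ := ih
      have e : monomial (n + 1) q = monomial n q * (Y : K[X][Y]) := by
        rw [monomial_mul_X]
      refine ⟨b * (X ^ 3 + C A * X + C B), a, fun x y h => ?_, fun x y h => ?_⟩
      · rw [e, evalEval_mul, h₁ x y h, evalEval_X]
        simp only [eval_mul, eval_add, eval_pow, eval_X, eval_C]
        linear_combination b.eval x * h
      · rw [e, map_mul, h₂ x y h, aevalAeval_Y]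
        simp only [map_mul, map_add, map_pow, aeval_X, aeval_C, TrivSqZeroExt.algebraMap_eq_inl]
        linear_combination aeval x b * h

/-- The degree of `a²` is even and the degree of `b² (x³ + A x + B)` is odd, unless they vanish. -/
theorem eq_zero_of_sq_eq {a b : K[X]} (h : a ^ 2 = b ^ 2 * (X ^ 3 + C A * X + C B)) :
    a = 0 ∧ b = 0 := by
  have hf : (X ^ 3 + C A * X + C B : K[X]).natDegree = 3 := by compute_degree!
  have hf0 : (X ^ 3 + C A * X + C B : K[X]) ≠ 0 := by
    intro h0; rw [h0] at hf; simp at hf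
  by_cases hb : b = 0
  · subst hb
    exact ⟨by simpa using h, rfl⟩
  · have h' := congrArg natDegree h
    rw [natDegree_mul (pow_ne_zero 2 hb) hf0, natDegree_pow, natDegree_pow, hf] at h'
    omega

/-- A polynomial in `x` and `y` that vanishes at infinitely many points of the curve vanishes at all
points of the curve and of its lift, as it is divisible by the equation. -/
theorem vanish_of_frequently {H : K[X][Y]}
    (hH : ∃ᶠ P : (curve A B).Point in cofinite, H.evalEval (xCoord P) (yCoord P) = 0)
    {x y : K[ε]} (h : y ^ 2 = x ^ 3 + inl A * x + inl B) : aevalAeval x y H = 0 := by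
  obtain ⟨a, b, h₁, h₂⟩ := exists_add_mul_y A B H
  have hab : a ^ 2 - b ^ 2 * (X ^ 3 + C A * X + C B) = 0 := by
    refine eq_zero_of_frequently (hH.mp ?_)
    filter_upwards [eventually_ne_point 0] with P hP h0
    have e := coord_equation hP
    rw [h₁ _ _ e] at h0
    simp only [eval_sub, eval_mul, eval_add, eval_pow, eval_X, eval_C]
    linear_combination (a.eval (xCoord P) - b.eval (xCoord P) * yCoord P) * h0 +
      b.eval (xCoord P) ^ 2 * e
  obtain ⟨rfl, rfl⟩ := eq_zero_of_sq_eq (sub_eq_zero.mp hab)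
  rw [h₂ x y h]
  simp

end Vanishing

/-! ### Values of rational functions at points of the lift -/

section Values

theorem fst_aeval {K : Type*} [Field K] (x : K[ε]) (q : K[X]) :
    (aeval x q).fst = q.eval x.fst := by
  simpa using (aeval_algHom_apply (fstHom K K K) x q).symm

variable {K : Type*} [Field K] {A B : K}

/-- The rational function on the curve that is given by `g` at almost all points is regular at the
reduction of the point `(x, y)` of the lift, and `c` is its value at `(x, y)`: there are polynomials
with `g = N / D` at almost all points, `D(x, y)` invertible and `c = N(x, y) / D(x, y)`. -/
def HasValue (x y : K[ε]) (g : (curve A B).Point → K) (c : K[ε]) : Prop :=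
  ∃ N D : K[X][Y], (aevalAeval x y D).fst ≠ 0 ∧ aevalAeval x y N = c * aevalAeval x y D ∧
    ∀ᶠ Q in cofinite, g Q * D.evalEval (xCoord Q) (yCoord Q) = N.evalEval (xCoord Q) (yCoord Q)

variable {x y : K[ε]} {g g' : (curve A B).Point → K} {c c' : K[ε]}

theorem HasValue.congr (hg : HasValue x y g c) (h : ∀ᶠ Q in cofinite, g' Q = g Q) :
    HasValue x y g' c := by
  obtain ⟨N, D, h₁, h₂, h₃⟩ := hg
  refine ⟨N, D, h₁, h₂, ?_⟩
  filter_upwards [h, h₃] with Q e₁ e₂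
  rw [e₁, e₂]

theorem hasValue_const (a : K) : HasValue x y (fun _ : (curve A B).Point => a) (inl a) := by
  refine ⟨CC a, 1, by simp, ?_, .of_forall fun Q => ?_⟩
  · simp [CC, TrivSqZeroExt.algebraMap_eq_inl]
  · rw [evalEval_one, evalEval_CC, mul_one]

theorem hasValue_xCoord : HasValue x y (xCoord : (curve A B).Point → K) x := by
  refine ⟨C X, 1, by simp, by simp, .of_forall fun Q => ?_⟩
  rw [evalEval_one, evalEval_C, eval_X, mul_one]

theorem hasValue_yCoord : HasValue x y (yCoord : (curve A B).Point → K) y := by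
  refine ⟨Y, 1, by simp, by simp, .of_forall fun Q => ?_⟩
  rw [evalEval_one, evalEval_X, mul_one]

theorem HasValue.add (hg : HasValue x y g c) (hg' : HasValue x y g' c') :
    HasValue x y (fun Q => g Q + g' Q) (c + c') := by
  obtain ⟨N, D, h₁, h₂, h₃⟩ := hg
  obtain ⟨N', D', h₁', h₂', h₃'⟩ := hg'
  refine ⟨N * D' + N' * D, D * D', ?_, ?_, ?_⟩
  · rw [map_mul, fst_mul]; exact mul_ne_zero h₁ h₁'
  · simp only [map_add, map_mul, h₂, h₂']; ring
  · filter_upwards [h₃, h₃'] with Q e e'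
    simp only [evalEval_add, evalEval_mul]
    linear_combination D'.evalEval (xCoord Q) (yCoord Q) * e +
      D.evalEval (xCoord Q) (yCoord Q) * e'

theorem HasValue.mul (hg : HasValue x y g c) (hg' : HasValue x y g' c') :
    HasValue x y (fun Q => g Q * g' Q) (c * c') := by
  obtain ⟨N, D, h₁, h₂, h₃⟩ := hg
  obtain ⟨N', D', h₁', h₂', h₃'⟩ := hg'
  refine ⟨N * N', D * D', ?_, ?_, ?_⟩
  · rw [map_mul, fst_mul]; exact mul_ne_zero h₁ h₁'
  · simp only [map_mul, h₂, h₂']; ring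
  · filter_upwards [h₃, h₃'] with Q e e'
    simp only [evalEval_mul, ← e, ← e']
    ring

theorem HasValue.neg (hg : HasValue x y g c) : HasValue x y (fun Q => -g Q) (-c) := by
  simpa using (hasValue_const (-1 : K)).mul hg

theorem HasValue.sub (hg : HasValue x y g c) (hg' : HasValue x y g' c') :
    HasValue x y (fun Q => g Q - g' Q) (c - c') := by
  simpa only [sub_eq_add_neg] using hg.add hg'.neg

theorem HasValue.pow (hg : HasValue x y g c) (n : ℕ) :
    HasValue x y (fun Q => g Q ^ n) (c ^ n) := by
  induction n with
  | zero => simpa using hasValue_const (1 : K)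
  | succ n ih => simpa only [pow_succ] using ih.mul hg

theorem HasValue.eval_polynomial (hg : HasValue x y g c) (q : K[X]) :
    HasValue x y (fun Q => q.eval (g Q)) (aeval c q) := by
  induction q using Polynomial.induction_on' with
  | add p q hp hq => simpa only [eval_add, map_add] using hp.add hq
  | monomial n a =>
    simpa only [eval_monomial, aeval_monomial, TrivSqZeroExt.algebraMap_eq_inl] using
      (hasValue_const a).mul (hg.pow n)

theorem HasValue.eval_bivariate (hg : HasValue x y g c) (hg' : HasValue x y g' c') (H : K[X][Y]) :
    HasValue x y (fun Q => H.evalEval (g Q) (g' Q)) (aevalAeval c c' H) := by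
  induction H using Polynomial.induction_on' with
  | add p q hp hq => simpa only [evalEval_add, map_add] using hp.add hq
  | monomial n a =>
    have e : monomial n a = C a * (Y : K[X][Y]) ^ n := (C_mul_X_pow_eq_monomial).symm
    simpa only [e, evalEval_mul, map_mul, evalEval_pow, map_pow, evalEval_C, evalEval_X,
      aevalAeval_C, aevalAeval_Y] using (hg.eval_polynomial a).mul (hg'.pow n)

/-- A rational function with a nonzero value at some point has only finitely many zeros. -/
theorem HasValue.eventually_ne (h : y ^ 2 = x ^ 3 + inl A * x + inl B) (hg : HasValue x y g c)
    (hc : c.fst ≠ 0) : ∀ᶠ Q in cofinite, g Q ≠ 0 := by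
  obtain ⟨N, D, h₁, h₂, h₃⟩ := hg
  have hN : ∀ᶠ Q : (curve A B).Point in cofinite, N.evalEval (xCoord Q) (yCoord Q) ≠ 0 := by
    by_contra hN
    have := vanish_of_frequently (not_eventually.mp hN |>.mono fun _ => not_not.mp) h
    rw [this] at h₂
    have := congrArg fst h₂
    rw [fst_mul, fst_zero] at this
    exact mul_ne_zero hc h₁ this.symm
  filter_upwards [h₃, hN] with Q e e' h0
  rw [h0, zero_mul] at e
  exact e' e.symm

theorem HasValue.inv (h : y ^ 2 = x ^ 3 + inl A * x + inl B) (hg : HasValue x y g c)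
    (hc : c.fst ≠ 0) : HasValue x y (fun Q => (g Q)⁻¹) c⁻¹ := by
  have hne := hg.eventually_ne h hc
  obtain ⟨N, D, h₁, h₂, h₃⟩ := hg
  refine ⟨D, N, ?_, ?_, ?_⟩
  · rw [h₂, fst_mul]; exact mul_ne_zero hc h₁
  · rw [h₂]; linear_combination -aevalAeval x y D * mul_inv_self hc
  · filter_upwards [h₃, hne] with Q e e'
    rw [← e, inv_mul_cancel_left₀ e']

theorem HasValue.unique [Infinite (curve A B).Point] (h : y ^ 2 = x ^ 3 + inl A * x + inl B)
    (hg : HasValue x y g c) (hg' : HasValue x y g c') : c = c' := by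
  obtain ⟨N, D, h₁, h₂, h₃⟩ := hg
  obtain ⟨N', D', h₁', h₂', h₃'⟩ := hg'
  have e := vanish_of_frequently (A := A) (B := B) (H := N * D' - N' * D)
    (Eventually.frequently <| by
    filter_upwards [h₃, h₃'] with Q e e'
    simp only [evalEval_sub, evalEval_mul]
    rw [← e, ← e']
    ring) h
  rw [map_sub, map_mul, map_mul, h₂, h₂'] at e
  have i := mul_inv_self h₁
  have i' := mul_inv_self h₁'
  generalize (aevalAeval x y D)⁻¹ = u at *
  generalize (aevalAeval x y D')⁻¹ = u' at *
  linear_combination u * u' * e + (c' - c) * (u' * aevalAeval x y D' * i + i')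

theorem HasValue.ratEval (h : y ^ 2 = x ^ 3 + inl A * x + inl B) (hg : HasValue x y g c)
    {r : RatFunc K} (hr : IsUnit (aeval c r.denom)) :
    HasValue x y (fun Q => r.eval (RingHom.id K) (g Q)) (ratEval r c) := by
  have hr' : (aeval c r.denom).fst ≠ 0 := by
    simpa [isUnit_iff_ne_zero] using isUnit_iff_isUnit_fst.mp hr
  simpa only [RatFunc.eval, eval₂_id, DualEC.ratEval, div_eq_mul_inv] using
    (hg.eval_polynomial r.num).mul ((hg.eval_polynomial r.denom).inv h hr')

/-- If a rational function `r(x)` of `x` is regular at a point of the curve, then its denominator in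
lowest terms does not vanish there. -/
theorem HasValue.denom_ne [Infinite (curve A B).Point] (h : y ^ 2 = x ^ 3 + inl A * x + inl B)
    {r : RatFunc K}
    (hg : HasValue (A := A) (B := B) x y (fun Q => r.eval (RingHom.id K) (xCoord Q)) c) :
    r.denom.eval x.fst ≠ 0 := by
  intro h0
  have hv := (hasValue_xCoord (A := A) (B := B) (x := x) (y := y)).eval_polynomial r.denom
  have hn := (hasValue_xCoord (A := A) (B := B) (x := x) (y := y)).eval_polynomial r.num
  have e := ((hg.mul hv).congr (g' := fun Q => r.num.eval (xCoord Q)) (by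
    filter_upwards [eventually_eval_xCoord_ne r.denom_ne_zero] with Q hQ
    simp only [RatFunc.eval, eval₂_id]
    rw [div_mul_cancel₀ _ hQ])).unique h hn
  have e' := congrArg fst e
  rw [fst_mul, fst_aeval, fst_aeval, h0, mul_zero] at e'
  obtain ⟨a, b, hab⟩ := r.isCoprime_num_denom
  have := congrArg (Polynomial.eval x.fst) hab
  simp [h0, ← e'] at this

end Values

/-! ### Values of rational maps at points of the lift -/

section PointValues

variable {K : Type*} [Field K] {A₁ B₁ A₂ B₂ : K}

/-- The rational map between the curves that is given by `ψ` at almost all points is regular at the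
reduction of the point `(x, y)` of the lift and sends `(x, y)` to the affine point `(x', y')`. -/
structure HasPointValue (x y : K[ε]) (ψ : (curve A₁ B₁).Point → (curve A₂ B₂).Point)
    (x' y' : K[ε]) : Prop where
  x_value : HasValue x y (fun Q => xCoord (ψ Q)) x'
  y_value : HasValue x y (fun Q => yCoord (ψ Q)) y'
  ne_zero : ∀ᶠ Q in cofinite, ψ Q ≠ 0

variable {x y x' y' : K[ε]} {ψ : (curve A₁ B₁).Point → (curve A₂ B₂).Point}

theorem HasPointValue.equation [Infinite (curve A₁ B₁).Point]
    (h : y ^ 2 = x ^ 3 + inl A₁ * x + inl B₁) (hψ : HasPointValue x y ψ x' y') :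
    y' ^ 2 = x' ^ 3 + inl A₂ * x' + inl B₂ := by
  refine ((hψ.y_value.pow 2).congr ?_).unique h ((((hψ.x_value.pow 3).add
    ((hasValue_const A₂).mul hψ.x_value)).add (hasValue_const B₂)))
  filter_upwards [hψ.ne_zero] with Q hQ
  rw [coord_equation hQ]

theorem HasPointValue.congr {ψ' : (curve A₁ B₁).Point → (curve A₂ B₂).Point}
    (hψ : HasPointValue x y ψ x' y') (h : ∀ᶠ Q in cofinite, ψ' Q = ψ Q) :
    HasPointValue x y ψ' x' y' where
  x_value := hψ.x_value.congr (h.mono fun _ h => by rw [h])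
  y_value := hψ.y_value.congr (h.mono fun _ h => by rw [h])
  ne_zero := by filter_upwards [hψ.ne_zero, h] with Q h h'; rwa [h']

theorem hasPointValue_id : HasPointValue x y (fun Q : (curve A₁ B₁).Point => Q) x y :=
  ⟨hasValue_xCoord, hasValue_yCoord, eventually_ne_point 0⟩

theorem ofCurve_eq_affine {T : (curve A₂ B₂).Point} (hT : T ≠ 0) :
    ∃ h, ofCurve T = .affine (inl (xCoord T)) (inl (yCoord T)) h := by
  rcases T with _ | ⟨x, y, h⟩
  · exact absurd rfl hT
  · exact ⟨_, rfl⟩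

variable [DecidableEq K]

/-- The value of the composite of a rational map with the translation by a point over `K`, in the
case in which the chord formula applies. -/
theorem HasPointValue.add_point (h : y ^ 2 = x ^ 3 + inl A₁ * x + inl B₁)
    (h' : y' ^ 2 = x' ^ 3 + inl A₂ * x' + inl B₂)
    (hψ : HasPointValue x y ψ x' y') {T : (curve A₂ B₂).Point} (hT : T ≠ 0)
    (hx : x'.fst ≠ xCoord T) :
    ∃ x'' y'' h'', LiftPoint.affine x' y' h' + ofCurve T = .affine x'' y'' h'' ∧
      HasPointValue x y (fun Q => ψ Q + T) x'' y'' := by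
  obtain ⟨hT', eT⟩ := ofCurve_eq_affine hT
  have hopp : ¬(x'.fst = (inl (xCoord T) : K[ε]).fst ∧ y'.fst = -(inl (yCoord T) : K[ε]).fst) :=
    fun h => hx h.1
  rw [eT, add_affine_of_not_opp hopp]
  refine ⟨_, _, _, rfl, ?_⟩
  have hs : slope A₂ x' y' (inl (xCoord T)) (inl (yCoord T)) =
      (y' - inl (yCoord T)) * (x' - inl (xCoord T))⁻¹ := if_pos hx
  rw [hs]
  have hd := hψ.x_value.sub (hasValue_const (xCoord T))
  have hd0 : (x' - inl (xCoord T)).fst ≠ 0 := by simpa [sub_eq_zero] using hx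
  have hne := hd.eventually_ne h hd0
  have hl := (hψ.y_value.sub (hasValue_const (yCoord T))).mul (hd.inv h hd0)
  have hX := (((hl.pow 2).sub hψ.x_value).sub (hasValue_const (xCoord T)))
  have key : ∀ᶠ Q in cofinite, ψ Q + T ≠ 0 ∧ xCoord (ψ Q + T) =
      ((yCoord (ψ Q) - yCoord T) * (xCoord (ψ Q) - xCoord T)⁻¹) ^ 2 - xCoord (ψ Q) - xCoord T ∧
      yCoord (ψ Q + T) = -((yCoord (ψ Q) - yCoord T) * (xCoord (ψ Q) - xCoord T)⁻¹ *
        (xCoord (ψ Q + T) - xCoord (ψ Q)) + yCoord (ψ Q)) := by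
    filter_upwards [hne, hψ.ne_zero] with Q h₁ h₂
    exact add_coord h₂ hT (sub_ne_zero.mp h₁)
  refine ⟨hX.congr ?_, ((hl.mul (hX.sub hψ.x_value)).add hψ.y_value).neg.congr ?_, ?_⟩
  · filter_upwards [key] with Q hQ using hQ.2.1
  · filter_upwards [key] with Q hQ
    rw [hQ.2.2, hQ.2.1]
  · filter_upwards [key] with Q hQ using hQ.1

end PointValues

/-! ### Reduction of points of the lift -/

section Reduction

variable {K : Type*} [Field K] {A B : K} [(curve A B).IsElliptic]

theorem reduction_affine {x y : K[ε]} (h : y ^ 2 = x ^ 3 + inl A * x + inl B) :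
    reduction (.affine x y h) ≠ 0 ∧ xCoord (reduction (.affine x y h)) = x.fst ∧
      yCoord (reduction (.affine x y h)) = y.fst :=
  ⟨WeierstrassCurve.Affine.Point.some_ne_zero _, rfl, rfl⟩

theorem exists_affine_of_reduction_ne_zero {P : LiftPoint A B} (hP : reduction P ≠ 0) :
    ∃ x y h, P = .affine x y h := by
  rcases P with ⟨x, y, h⟩ | k
  · exact ⟨x, y, h, rfl⟩
  · exact absurd rfl hP

variable [DecidableEq K]

theorem reduction_sumPoint (P : (curve A B).Point) (k : K) : reduction (sumPoint P k) = P := by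
  rcases P with _ | ⟨x, y, h⟩
  · change reduction (sumPoint 0 k) = _
    rw [sumPoint_zero]; rfl
  · rw [sumPoint_some]
    exact point_ext (reduction_affine _).1 (WeierstrassCurve.Affine.Point.some_ne_zero _)
      ((reduction_affine _).2.1.trans (by simp)) ((reduction_affine _).2.2.trans (by simp))

theorem ofCurve_eq_sumPoint (P : (curve A B).Point) : ofCurve P = sumPoint P 0 :=
  (add_zero (ofCurve P)).symm

theorem sumPoint_injective {P Q : (curve A B).Point} {k l : K} (h : sumPoint P k = sumPoint Q l) :
    P = Q ∧ k = l := by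
  have hPQ : P = Q := by rw [← reduction_sumPoint P k, h, reduction_sumPoint]
  subst hPQ
  refine ⟨rfl, ?_⟩
  have h' : (LiftPoint.inf k : LiftPoint A B) = .inf l := add_left_cancel h
  injection h'

theorem reduction_add (P Q : LiftPoint A B) :
    reduction (P + Q) = reduction P + reduction Q := by
  obtain ⟨P, k, rfl⟩ := sumPoint_surjective P
  obtain ⟨Q, l, rfl⟩ := sumPoint_surjective Q
  simp only [sumPoint_add, reduction_sumPoint]

end Reduction

/-! ### The standard form of an isogeny -/

section StandardForm

variable {K : Type*} [Field K]

theorem ratFunc_div_eval (n : K[X]) {d : K[X]} {x : K} (hx : d.eval x ≠ 0) :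
    (algebraMap K[X] (RatFunc K) n / algebraMap K[X] (RatFunc K) d).denom.eval x ≠ 0 ∧
    (algebraMap K[X] (RatFunc K) n / algebraMap K[X] (RatFunc K) d).eval (RingHom.id K) x =
      n.eval x / d.eval x := by
  have hd : d ≠ 0 := by rintro rfl; simp at hx
  set r := algebraMap K[X] (RatFunc K) n / algebraMap K[X] (RatFunc K) d with hr
  obtain ⟨q, hq⟩ : r.denom ∣ d := RatFunc.denom_div_dvd n d
  have h₁ : r.denom.eval x ≠ 0 := by
    intro h0
    rw [hq, eval_mul, h0, zero_mul] at hx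
    exact hx rfl
  refine ⟨h₁, ?_⟩
  have e := congrArg (eval x) ((RatFunc.num_mul_eq_mul_denom_iff hd).mpr hr)
  rw [eval_mul, eval_mul] at e
  simp only [RatFunc.eval, eval₂_id]
  rw [div_eq_div_iff h₁ hx, e]

theorem ratFunc_ext {r r' : RatFunc K} (h : r.num * r'.denom = r'.num * r.denom) : r = r' := by
  rw [← RatFunc.num_div_denom r']
  exact (RatFunc.num_mul_eq_mul_denom_iff r'.denom_ne_zero).mp h

variable {A₁ B₁ A₂ B₂ : K}

theorem ratFunc_eq_of_eventually [Infinite (curve A₁ B₁).Point] {r r' : RatFunc K}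
    (h : ∀ᶠ P : (curve A₁ B₁).Point in cofinite,
      r.eval (RingHom.id K) (xCoord P) = r'.eval (RingHom.id K) (xCoord P)) : r = r' := by
  refine ratFunc_ext (sub_eq_zero.mp (eq_zero_of_frequently (A := A₁) (B := B₁)
    (Eventually.frequently ?_)))
  filter_upwards [h, eventually_eval_xCoord_ne r.denom_ne_zero,
    eventually_eval_xCoord_ne r'.denom_ne_zero] with P h₁ h₂ h₃
  simp only [RatFunc.eval, eval₂_id] at h₁
  rw [div_eq_div_iff h₂ h₃] at h₁
  rw [eval_sub, eval_mul, eval_mul, h₁, sub_self]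

variable [DecidableEq K] {φ : (curve A₁ B₁).Point →+ (curve A₂ B₂).Point}

/-- `Generically` in terms of the coordinate functions. -/
theorem generically_iff {R : K → K → K → K → Prop} : Generically φ R ↔
    ∀ᶠ P in cofinite, φ P ≠ 0 ∧ R (xCoord P) (yCoord P) (xCoord (φ P)) (yCoord (φ P)) := by
  constructor
  · intro h
    filter_upwards [h] with P hP
    obtain ⟨x, y, h, x', y', h', rfl, e, hR⟩ := hP
    rw [e]
    exact ⟨WeierstrassCurve.Affine.Point.some_ne_zero _, hR⟩
  · intro h
    filter_upwards [h, eventually_ne_point 0] with P hP h0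
    obtain ⟨h₁, e₁⟩ := exists_some h0
    obtain ⟨h₂, e₂⟩ := exists_some hP.1
    exact ⟨_, _, h₁, _, _, h₂, e₁, e₂, hP.2⟩

theorem hasStandardForm_iff {r s : RatFunc K} : HasStandardForm φ r s ↔
    ∀ᶠ P in cofinite, φ P ≠ 0 ∧ r.denom.eval (xCoord P) ≠ 0 ∧ s.denom.eval (xCoord P) ≠ 0 ∧
      xCoord (φ P) = r.eval (RingHom.id K) (xCoord P) ∧
      yCoord (φ P) = yCoord P * s.eval (RingHom.id K) (xCoord P) :=
  generically_iff

/-- As `φ (-P) = -φ P`, the two coordinates of `φ` are an even and an odd function of `y`. -/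
theorem exists_hasStandardForm [(curve A₁ B₁).IsElliptic] (hφ : IsIsogeny φ) :
    ∃ r s : RatFunc K, HasStandardForm φ r s := by
  obtain ⟨N₁, D₁, N₂, D₂, h⟩ := hφ
  obtain ⟨a₁, b₁, hN₁, -⟩ := exists_add_mul_y A₁ B₁ N₁
  obtain ⟨c₁, d₁, hD₁, -⟩ := exists_add_mul_y A₁ B₁ D₁
  obtain ⟨a₂, b₂, hN₂, -⟩ := exists_add_mul_y A₁ B₁ N₂
  obtain ⟨c₂, d₂, hD₂, -⟩ := exists_add_mul_y A₁ B₁ D₂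
  let f : K[X] := X ^ 3 + C A₁ * X + C B₁
  refine ⟨algebraMap K[X] (RatFunc K) (a₁ * c₁ - b₁ * d₁ * f) /
    algebraMap K[X] (RatFunc K) (c₁ ^ 2 - d₁ ^ 2 * f),
    algebraMap K[X] (RatFunc K) (b₂ * c₂ - a₂ * d₂) /
    algebraMap K[X] (RatFunc K) (c₂ ^ 2 - d₂ ^ 2 * f), ?_⟩
  rw [hasStandardForm_iff]
  have h := generically_iff.mp h
  have two := (disc_ne (A := A₁) (B := B₁)).1
  filter_upwards [h, neg_injective.tendsto_cofinite.eventually h, eventually_ne_point 0]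
    with P hP hP' h0
  obtain ⟨h₀, h₁, h₂, h₃, h₄⟩ := hP
  obtain ⟨-, h₁', h₂', h₃', h₄'⟩ := hP'
  have e := coord_equation h0
  rw [map_neg, xCoord_neg, xCoord_neg, yCoord_neg] at h₃'
  rw [map_neg, xCoord_neg, yCoord_neg, yCoord_neg] at h₄'
  rw [xCoord_neg, yCoord_neg] at h₁' h₂'
  generalize xCoord P = x at *
  generalize yCoord P = y at *
  generalize xCoord (φ P) = x' at *
  generalize yCoord (φ P) = y' at *
  have e' : (-y) ^ 2 = x ^ 3 + A₁ * x + B₁ := by rw [neg_sq, e]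
  rw [hD₁ _ _ e] at h₁ h₃
  rw [hD₁ _ _ e'] at h₁' h₃'
  rw [hD₂ _ _ e] at h₂ h₄
  rw [hD₂ _ _ e'] at h₂' h₄'
  rw [hN₁ _ _ e, eq_div_iff h₁] at h₃
  rw [hN₁ _ _ e', eq_div_iff h₁'] at h₃'
  rw [hN₂ _ _ e, eq_div_iff h₂] at h₄
  rw [hN₂ _ _ e', eq_div_iff h₂'] at h₄'
  have hf : f.eval x = y ^ 2 := by
    simp only [f, eval_add, eval_mul, eval_pow, eval_X, eval_C]
    exact e.symm
  have k₁ : (c₁ ^ 2 - d₁ ^ 2 * f).eval x =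
      (c₁.eval x + d₁.eval x * y) * (c₁.eval x + d₁.eval x * -y) := by
    simp only [eval_sub, eval_mul, eval_pow, hf]; ring
  have k₂ : (c₂ ^ 2 - d₂ ^ 2 * f).eval x =
      (c₂.eval x + d₂.eval x * y) * (c₂.eval x + d₂.eval x * -y) := by
    simp only [eval_sub, eval_mul, eval_pow, hf]; ring
  have n₁ : (c₁ ^ 2 - d₁ ^ 2 * f).eval x ≠ 0 := by rw [k₁]; exact mul_ne_zero h₁ h₁'
  have n₂ : (c₂ ^ 2 - d₂ ^ 2 * f).eval x ≠ 0 := by rw [k₂]; exact mul_ne_zero h₂ h₂'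
  obtain ⟨i₁, j₁⟩ := ratFunc_div_eval (a₁ * c₁ - b₁ * d₁ * f) n₁
  obtain ⟨i₂, j₂⟩ := ratFunc_div_eval (b₂ * c₂ - a₂ * d₂) n₂
  refine ⟨h₀, i₁, i₂, ?_, ?_⟩
  · rw [j₁, eq_div_iff n₁, k₁]
    apply mul_left_cancel₀ two
    simp only [eval_sub, eval_mul, hf]
    linear_combination (c₁.eval x + d₁.eval x * -y) * h₃ + (c₁.eval x + d₁.eval x * y) * h₃'
  · rw [j₂, ← mul_div_assoc, eq_div_iff n₂, k₂]
    apply mul_left_cancel₀ two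
    simp only [eval_sub, eval_mul]
    linear_combination (c₂.eval x + d₂.eval x * -y) * h₄ - (c₂.eval x + d₂.eval x * y) * h₄'

theorem HasStandardForm.unique [Infinite (curve A₁ B₁).Point] {r s r' s' : RatFunc K}
    (h : HasStandardForm φ r s) (h' : HasStandardForm φ r' s') : r = r' ∧ s = s' := by
  rw [hasStandardForm_iff] at h h'
  constructor
  · refine ratFunc_eq_of_eventually (A₁ := A₁) (B₁ := B₁) ?_
    filter_upwards [h, h'] with P hP hP'
    rw [← hP.2.2.2.1, hP'.2.2.2.1]
  · refine ratFunc_eq_of_eventually (A₁ := A₁) (B₁ := B₁) ?_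
    filter_upwards [h, h', eventually_yCoord_ne] with P hP hP' hy
    exact mul_left_cancel₀ hy (by rw [← hP.2.2.2.2, hP'.2.2.2.2])

end StandardForm

/-! ### Evaluation at dual numbers -/

section DualEvaluation

variable {K : Type*} [Field K]

theorem snd_aeval (x : K[ε]) (q : K[X]) :
    (aeval x q).snd = (derivative q).eval x.fst * x.snd := by
  induction q using Polynomial.induction_on with
  | C a => simp [TrivSqZeroExt.algebraMap_eq_inl]
  | add p q hp hq => simp [hp, hq, add_mul]
  | monomial n a h =>
    have e : C a * X ^ (n + 1) = C a * X ^ n * X := by ring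
    rw [e, map_mul, DualNumber.snd_mul, h, fst_aeval, aeval_X]
    rw [derivative_mul (f := C a * X ^ n)]
    simp only [eval_add, eval_mul, eval_X, derivative_X, eval_one]
    ring

theorem isUnit_aeval_iff {x : K[ε]} {q : K[X]} : IsUnit (aeval x q) ↔ q.eval x.fst ≠ 0 := by
  rw [isUnit_iff_isUnit_fst, fst_aeval, isUnit_iff_ne_zero]

theorem fst_ratEval (r : RatFunc K) (x : K[ε]) :
    (ratEval r x).fst = r.eval (RingHom.id K) x.fst := by
  simp only [ratEval, fst_mul, fst_inv, fst_aeval, RatFunc.eval, eval₂_id, div_eq_mul_inv]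

theorem snd_ratEval {r : RatFunc K} {x : K[ε]} (h : r.denom.eval x.fst ≠ 0) :
    (ratEval r x).snd = (ratDeriv r).eval (RingHom.id K) x.fst * x.snd := by
  have h2 : (r.denom ^ 2).eval x.fst ≠ 0 := by rw [eval_pow]; exact pow_ne_zero 2 h
  rw [ratDeriv, (ratFunc_div_eval _ h2).2]
  simp only [ratEval, DualNumber.snd_mul, snd_inv, fst_inv, fst_aeval, snd_aeval, eval_sub,
    eval_mul, eval_pow, smul_eq_mul, MulOpposite.smul_eq_mul_unop, MulOpposite.unop_op]
  field_simp
  ring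

end DualEvaluation

/-! ### Evaluation of the standard form outside the kernel -/

section Evaluation

variable {K : Type*} [Field K] {A₁ B₁ A₂ B₂ : K} {r s : RatFunc K}

theorem EvaluatesTo.unique {P : LiftPoint A₁ B₁} {Q Q' : LiftPoint A₂ B₂}
    (h : EvaluatesTo r s P Q) (h' : EvaluatesTo r s P Q') : Q = Q' := by
  obtain ⟨x, y, e, e', rfl, -, -, rfl⟩ := h
  obtain ⟨x₁, y₁, e₁, e₁', h₁, -, -, rfl⟩ := h'
  injection h₁ with hx hy
  subst hx hy
  rfl

variable [DecidableEq K] {φ : (curve A₁ B₁).Point →+ (curve A₂ B₂).Point}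

/-- The fibres of an isogeny are finite, since almost no points are in the kernel. -/
theorem HasStandardForm.tendsto (h : HasStandardForm φ r s) : Tendsto φ cofinite cofinite :=
  tendsto_cofinite_of_finite_ker φ ((hasStandardForm_iff.mp h).mono fun _ h => h.1)

theorem HasStandardForm.eventually_eval_ne (hφ : HasStandardForm φ r s) :
    ∀ᶠ q : (curve A₁ B₁).Point in cofinite, s.eval (RingHom.id K) (xCoord q) ≠ 0 := by
  filter_upwards [hasStandardForm_iff.mp hφ, hφ.tendsto.eventually eventually_yCoord_ne]
    with q hq hy h0
  rw [hq.2.2.2.2, h0, mul_zero] at hy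
  exact hy rfl

variable [(curve A₁ B₁).IsElliptic]

/-- The coefficient of `ε` in the `x`-coordinate of the value at `q + O_k`. -/
theorem EvaluatesTo.mul_eq {q : (curve A₁ B₁).Point} {k κ : K}
    (h : EvaluatesTo r s (sumPoint q k) (sumPoint (φ q) κ)) (hφq : φ q ≠ 0)
    (hy : yCoord q ≠ 0) (hs : yCoord (φ q) = yCoord q * s.eval (RingHom.id K) (xCoord q)) :
    s.eval (RingHom.id K) (xCoord q) * κ = (ratDeriv r).eval (RingHom.id K) (xCoord q) * k := by
  have hq : q ≠ 0 := by rintro rfl; exact hφq (map_zero φ)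
  obtain ⟨n₁, e₁⟩ := exists_some hq
  obtain ⟨n₂, e₂⟩ := exists_some hφq
  generalize φ q = q' at *
  obtain ⟨x, y, h, h', e, hr, -, e'⟩ := h
  rw [e₁, sumPoint_some] at e
  rw [e₂, sumPoint_some] at e'
  injection e with ex _
  injection e' with ex' _
  rw [isUnit_aeval_iff] at hr
  have hsnd := congrArg snd ex'
  rw [snd_ratEval hr, ← ex] at hsnd
  simp [two_eq] at hsnd
  rw [hs] at hsnd
  have two := (disc_ne (A := A₁) (B := B₁)).1
  apply mul_left_cancel₀ (mul_ne_zero two hy)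
  linear_combination hsnd

variable [IsAlgClosed K]

/-- The equation `(x³ + A₁ x + B₁) s² = r³ + A₂ r + B₂`, without denominators. -/
theorem HasStandardForm.equation (h : HasStandardForm φ r s) :
    (X ^ 3 + C A₁ * X + C B₁) * (s.num ^ 2 * r.denom ^ 3) =
      s.denom ^ 2 * (r.num ^ 3 + C A₂ * r.num * r.denom ^ 2 + C B₂ * r.denom ^ 3) := by
  refine sub_eq_zero.mp (eq_zero_of_frequently (A := A₁) (B := B₁) (Eventually.frequently ?_))
  filter_upwards [hasStandardForm_iff.mp h, eventually_ne_point 0] with P hP h0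
  obtain ⟨h₀, h₁, h₂, h₃, h₄⟩ := hP
  have e := coord_equation h0
  have e' := coord_equation h₀
  simp only [RatFunc.eval, eval₂_id] at h₃ h₄
  rw [h₃, h₄] at e'
  simp only [eval_sub, eval_mul, eval_add, eval_pow, eval_X, eval_C, ← e]
  field_simp at e'
  linear_combination e'

/-- Where `r` is regular, so is `s`: a pole of `s` would be a double zero of `x³ + A₁ x + B₁`. -/
theorem HasStandardForm.denom_snd_ne (h : HasStandardForm φ r s) {x : K}
    (hr : r.denom.eval x ≠ 0) : s.denom.eval x ≠ 0 := by
  intro hs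
  have hn : s.num.eval x ≠ 0 := by
    intro h0
    obtain ⟨a, b, hab⟩ := s.isCoprime_num_denom
    have := congrArg (Polynomial.eval x) hab
    simp [h0, hs] at this
  have e := h.equation
  have e₀ := congrArg (Polynomial.eval x) e
  have e₁ := congrArg (fun q => (derivative q).eval x) e
  simp only [derivative_mul, eval_add, eval_mul, eval_pow, hs, derivative_pow,
    Nat.cast_ofNat] at e₀ e₁
  norm_num at e₁
  have f₀ : x ^ 3 + A₁ * x + B₁ = 0 := by
    simpa [hn, hr] using e₀
  refine deriv_ne f₀ ?_
  have f₁ : (3 * x ^ 2 + A₁) * (s.num.eval x ^ 2 * r.denom.eval x ^ 3) = 0 := by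
    simp [f₀] at e₁
    simpa [hn, hr] using e₁
  simpa [hn, hr] using f₁

/-- If `φ` itself, known at almost all points, is regular at a point of the lift, then the formula
`(r(x), y s(x))` can be evaluated there and gives the value of `φ`. -/
theorem HasPointValue.evaluatesTo (hφ : HasStandardForm φ r s) {x y x' y' : K[ε]}
    (h : y ^ 2 = x ^ 3 + inl A₁ * x + inl B₁) (h' : y' ^ 2 = x' ^ 3 + inl A₂ * x' + inl B₂)
    (hv : HasPointValue x y φ x' y') :
    EvaluatesTo r s (.affine x y h) (.affine x' y' h') := by
  have hf := hasStandardForm_iff.mp hφ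
  have hx := hv.x_value.congr (g' := fun Q => r.eval (RingHom.id K) (xCoord Q))
    (hf.mono fun Q hQ => hQ.2.2.2.1.symm)
  have hr := hx.denom_ne h
  have hr' := isUnit_aeval_iff.mpr hr
  have hs' := isUnit_aeval_iff.mpr (hφ.denom_snd_ne hr)
  have hy := hv.y_value.congr (g' := fun Q => yCoord Q * s.eval (RingHom.id K) (xCoord Q))
    (hf.mono fun Q hQ => hQ.2.2.2.2.symm)
  exact ⟨x, y, h, _, rfl, hr', hs', affine_ext (hx.unique h (hasValue_xCoord.ratEval h hr'))
    (hy.unique h (hasValue_yCoord.mul (hasValue_xCoord.ratEval h hs')))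
    (h' := by
      rw [← hx.unique h (hasValue_xCoord.ratEval h hr'),
        ← hy.unique h (hasValue_yCoord.mul (hasValue_xCoord.ratEval h hs'))]
      exact h')⟩

/-- The composite of `φ` with a rational map has the value predicted by `(r(x), y s(x))`. -/
theorem HasPointValue.comp_standardForm (hφ : HasStandardForm φ r s) {x y x' y' : K[ε]}
    (h : y ^ 2 = x ^ 3 + inl A₁ * x + inl B₁)
    {ψ : (curve A₁ B₁).Point → (curve A₁ B₁).Point} (hψ : Tendsto ψ cofinite cofinite)
    (hv : HasPointValue x y ψ x' y') (hr : r.denom.eval x'.fst ≠ 0) :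
    HasPointValue x y (fun Q => φ (ψ Q)) (ratEval r x') (y' * ratEval s x') := by
  have hf := hψ.eventually (hasStandardForm_iff.mp hφ)
  refine ⟨(hv.x_value.ratEval h (isUnit_aeval_iff.mpr hr)).congr ?_,
    (hv.y_value.mul
      (hv.x_value.ratEval h (isUnit_aeval_iff.mpr (hφ.denom_snd_ne hr)))).congr ?_,
    hf.mono fun Q hQ => hQ.1⟩
  · filter_upwards [hf] with Q hQ using hQ.2.2.2.1
  · filter_upwards [hf] with Q hQ using hQ.2.2.2.2

variable [(curve A₂ B₂).IsElliptic]

/-- At a lift `P` of a point outside the kernel, `(r(x), y s(x))` takes the value at `P` of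
`τ_{φ(-T)} ∘ (r(x), y s(x)) ∘ τ_T` for almost all `T`, with `τ` for translation. The translation
moves `P` to where `(r(x), y s(x))` is known to represent `φ`. -/
theorem HasStandardForm.evaluatesTo_translate (hφ : HasStandardForm φ r s) {P : LiftPoint A₁ B₁}
    (hP : φ (reduction P) ≠ 0) :
    ∀ᶠ T in cofinite, ∃ Q, reduction Q = φ (reduction P + T) ∧
      EvaluatesTo r s (P + ofCurve T) Q ∧ EvaluatesTo r s P (Q + ofCurve (φ (-T))) := by
  obtain ⟨x, y, h, rfl⟩ := exists_affine_of_reduction_ne_zero (P := P) (by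
    rintro h0; rw [h0, map_zero] at hP; exact hP rfl)
  set p := reduction (.affine x y h) with hp
  obtain ⟨hp0, hpx, -⟩ := reduction_affine h
  rw [← hp] at hp0 hpx
  have hf := hasStandardForm_iff.mp hφ
  -- `T ≠ ± p` for the first chord, and `φ T ≠ ± φ (p + T)` for the second.
  have c₁ : ∀ᶠ T : (curve A₁ B₁).Point in cofinite, xCoord T ≠ x.fst :=
    tendsto_xCoord.eventually ((Set.finite_singleton x.fst).compl_mem_cofinite)
  have c₂ : ∀ᶠ T in cofinite, φ T + φ T ≠ -φ p :=
    hφ.tendsto.eventually (tendsto_add_self.eventually (eventually_ne_point _))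
  filter_upwards [c₁, c₂, eventually_ne_point 0, (tendsto_add_left p).eventually hf, hf]
    with T k₁ k₂ k₃ k₄ k₅
  obtain ⟨l₀, l₁, -, l₃, l₄⟩ := k₄
  obtain ⟨x₁, y₁, h₁, e₁, v₁⟩ := (hasPointValue_id (x := x) (y := y)).add_point h h k₃ k₁.symm
  have hred : reduction (.affine x₁ y₁ h₁) = p + T := by
    rw [← e₁, reduction_add, ofCurve_eq_sumPoint, reduction_sumPoint]
  obtain ⟨hq0, hqx, hqy⟩ := reduction_affine h₁
  rw [hred] at hq0 hqx hqy
  rw [hqx] at l₁ l₃ l₄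
  rw [hqy] at l₄
  have v₂ := v₁.comp_standardForm hφ h (add_left_injective T).tendsto_cofinite l₁
  have h₂ := v₂.equation h
  have k₆ : φ (-T) ≠ 0 := by
    intro h0
    rw [map_neg] at h0
    exact k₅.1 (by rw [← neg_neg (φ T), h0, neg_zero])
  have hred₂ : reduction (.affine _ _ h₂) = φ (p + T) := by
    refine point_ext (reduction_affine h₂).1 l₀ ?_ ?_
    · rw [(reduction_affine h₂).2.1, fst_ratEval, l₃]
    · rw [(reduction_affine h₂).2.2, fst_mul, fst_ratEval, l₄]
  have k₇ : (ratEval r x₁).fst ≠ xCoord (φ (-T)) := by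
    rw [← (reduction_affine h₂).2.1, hred₂]
    intro h0
    rcases eq_or_eq_neg_of_xCoord_eq l₀ k₆ h0 with h0 | h0
    · refine k₂ ?_
      rw [map_add, map_neg] at h0
      have : φ p + (φ T + φ T) = 0 := by rw [← add_assoc, h0, neg_add_cancel]
      exact eq_neg_of_add_eq_zero_right this
    · rw [map_add, map_neg, neg_neg] at h0
      exact hP (by simpa using h0)
  obtain ⟨x₃, y₃, h₃, e₃, v₃⟩ := v₂.add_point h h₂ k₆ k₇
  refine ⟨.affine _ _ h₂, hred₂, ?_, ?_⟩
  · rw [e₁]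
    exact ⟨x₁, y₁, h₁, h₂, rfl, isUnit_aeval_iff.mpr l₁,
      isUnit_aeval_iff.mpr (hφ.denom_snd_ne l₁), rfl⟩
  · rw [e₃]
    refine HasPointValue.evaluatesTo hφ h h₃ (v₃.congr (.of_forall fun Q => ?_))
    rw [← map_add, add_neg_cancel_right]

/-- The value of `(r(x), y s(x))` at `P + O_k` differs from `φ P` by the same `O_κ` for almost all
points `P`. -/
theorem HasStandardForm.eventually_evaluatesTo (hφ : HasStandardForm φ r s)
    {p : (curve A₁ B₁).Point} (hp : φ p ≠ 0) (k : K) :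
    ∃ κ, EvaluatesTo r s (sumPoint p k) (sumPoint (φ p) κ) ∧
      ∀ᶠ q in cofinite, EvaluatesTo r s (sumPoint q k) (sumPoint (φ q) κ) := by
  have h := hφ.evaluatesTo_translate (P := sumPoint p k) (by rwa [reduction_sumPoint])
  simp only [reduction_sumPoint] at h
  obtain ⟨T₀, Q₀, hQ₀, h₀, h₀'⟩ := h.exists
  have key : ∀ T Q, reduction Q = φ (p + T) →
      ∃ κ, Q = sumPoint (φ (p + T)) κ ∧ Q + ofCurve (φ (-T)) = sumPoint (φ p) κ := by
    intro T Q hQ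
    obtain ⟨R, κ, rfl⟩ := sumPoint_surjective Q
    rw [reduction_sumPoint] at hQ
    subst hQ
    refine ⟨κ, rfl, ?_⟩
    rw [ofCurve_eq_sumPoint, sumPoint_add, add_zero, ← map_add, add_neg_cancel_right]
  obtain ⟨κ, -, e₀⟩ := key T₀ Q₀ hQ₀
  rw [e₀] at h₀'
  refine ⟨κ, h₀', ?_⟩
  filter_upwards [(tendsto_add_left (-p)).eventually h] with q hq
  obtain ⟨Q, hQ, h₁, h₁'⟩ := hq
  obtain ⟨κ', e₁, e₂⟩ := key _ Q hQ
  rw [e₂] at h₁'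
  obtain rfl : κ' = κ := (sumPoint_injective (h₁'.unique h₀')).2
  rwa [e₁, ofCurve_eq_sumPoint, sumPoint_add, add_neg_cancel_left, add_zero] at h₁

/-- The pullback by `φ` of the invariant differential `dx / y` is a constant multiple of it:
`r'(x) dx / (y s(x)) = m dx / y`. In terms of the lifts, `φ (P + O_k) = φ P + O_{m k}`. -/
theorem HasStandardForm.exists_multiplier (hφ : HasStandardForm φ r s) :
    ∃ m : K, s * RatFunc.C m = ratDeriv r ∧ ∀ p, φ p ≠ 0 → ∀ k,
      EvaluatesTo r s (sumPoint p k) (sumPoint (φ p) (m * k)) := by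
  have hf := hasStandardForm_iff.mp hφ
  have key : ∀ k κ, (∀ᶠ q in cofinite, EvaluatesTo r s (sumPoint q k) (sumPoint (φ q) κ)) →
      ∀ᶠ q : (curve A₁ B₁).Point in cofinite, s.eval (RingHom.id K) (xCoord q) * κ =
        (ratDeriv r).eval (RingHom.id K) (xCoord q) * k := by
    intro k κ h
    filter_upwards [h, hf, eventually_yCoord_ne] with q h₁ h₂ h₃
    exact h₁.mul_eq h₂.1 h₃ h₂.2.2.2.2
  obtain ⟨p₀, hp₀⟩ := hf.exists
  obtain ⟨m, -, hm⟩ := hφ.eventually_evaluatesTo hp₀.1 1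
  have hm' := key 1 m hm
  refine ⟨m, ?_, fun p hp k => ?_⟩
  · refine ratFunc_eq_of_eventually (A₁ := A₁) (B₁ := B₁) ?_
    filter_upwards [hm', hf] with q h₁ h₂
    rw [RatFunc.eval_mul (RingHom.id K) _ (by simpa [eval₂_id] using h₂.2.2.1) (by simp),
      RatFunc.eval_C, RingHom.id_apply,
      h₁, mul_one]
  · obtain ⟨κ, h₁, h₂⟩ := hφ.eventually_evaluatesTo hp k
    obtain ⟨q, e₁, e₂, e₃⟩ := ((key k κ h₂).and (hm'.and hφ.eventually_eval_ne)).exists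
    have : κ = m * k := mul_left_cancel₀ e₃ (by rw [e₁]; linear_combination -k * e₂)
    rwa [← this]

end Evaluation

/-! ### Local computations at infinity -/

section Infinity

variable {K : Type*} [Field K] {A B : K}

theorem fst_aevalAeval (x y : K[ε]) (H : K[X][Y]) :
    (aevalAeval x y H).fst = H.evalEval x.fst y.fst := by
  induction H using Polynomial.induction_on' with
  | add p q hp hq => rw [map_add, fst_add, hp, hq, evalEval_add]
  | monomial n a =>
    have e : monomial n a = C a * (Y : K[X][Y]) ^ n := (C_mul_X_pow_eq_monomial).symm
    rw [e, map_mul, map_pow, aevalAeval_C, aevalAeval_Y, evalEval_mul, evalEval_pow, evalEval_C,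
      evalEval_X, fst_mul, fst_pow, fst_aeval]

theorem exists_ne_zero_and_yCoord_ne_zero [Infinite (curve A B).Point]
    {p : (curve A B).Point → Prop}
    (h : ∀ᶠ T in cofinite, p T) : ∃ T : (curve A B).Point, T ≠ 0 ∧ yCoord T ≠ 0 ∧ p T :=
  ((eventually_ne_point 0).and (eventually_yCoord_ne.and h)).exists

variable [DecidableEq K]

/-- The functions `1 / x`, `x / y` and `1 / y` vanish at infinity. Here the translation by `T`
moves `-T`, where the local computation takes place, to infinity. -/
theorem hasValue_infinity [(curve A B).IsElliptic] {T : (curve A B).Point} (hT : T ≠ 0)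
    (hy : yCoord T ≠ 0) :
    HasValue (inl (xCoord T)) (inl (-yCoord T)) (fun Q => (xCoord (Q + T))⁻¹) 0 ∧
    HasValue (inl (xCoord T)) (inl (-yCoord T)) (fun Q => xCoord (Q + T) / yCoord (Q + T)) 0 ∧
    HasValue (inl (xCoord T)) (inl (-yCoord T)) (fun Q => 1 / yCoord (Q + T)) 0 := by
  have two := (disc_ne (A := A) (B := B)).1
  have h : (inl (-yCoord T) : K[ε]) ^ 2 =
      inl (xCoord T) ^ 3 + inl A * inl (xCoord T) + inl B :=
    equation_of (by simpa using coord_equation hT) (by simp)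
  generalize ha : xCoord T = a at *
  generalize hb : yCoord T = b at *
  have vx := hasValue_xCoord (A := A) (B := B) (x := inl a) (y := inl (-b))
  have vy := hasValue_yCoord (A := A) (B := B) (x := inl a) (y := inl (-b))
  have vd := vx.sub (hasValue_const a)
  have vn := vy.sub (hasValue_const b)
  rw [sub_self] at vd
  -- The numerators of `x(Q + T)` and `y(Q + T)`, over the denominators `(x - a)²` and `(x - a)³`.
  have vX := (vn.pow 2).sub ((vd.pow 2).mul (vx.add (hasValue_const a)))
  have vY := ((vn.mul (vX.sub (vx.mul (vd.pow 2)))).add (vy.mul (vd.pow 3))).neg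
  have hb2 : -b - b ≠ 0 := by
    rw [show -b - b = -(2 * b) by ring]
    exact neg_ne_zero.mpr (mul_ne_zero two hy)
  have nX := vX.inv h (by simpa using hb2)
  have nY := vY.inv h (by simpa using hb2)
  have key : ∀ᶠ Q : (curve A B).Point in cofinite, xCoord Q - a ≠ 0 ∧
      xCoord (Q + T) = ((yCoord Q - b) ^ 2 - (xCoord Q - a) ^ 2 * (xCoord Q + a)) /
        (xCoord Q - a) ^ 2 ∧
      yCoord (Q + T) = -((yCoord Q - b) * ((yCoord Q - b) ^ 2 - (xCoord Q - a) ^ 2 *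
        (xCoord Q + a) - xCoord Q * (xCoord Q - a) ^ 2) + yCoord Q * (xCoord Q - a) ^ 3) /
        (xCoord Q - a) ^ 3 := by
    filter_upwards [eventually_ne_point 0,
      tendsto_xCoord.eventually ((Set.finite_singleton a).compl_mem_cofinite)] with Q h₁ h₂
    have hd : xCoord Q - a ≠ 0 := sub_ne_zero.mpr h₂
    obtain ⟨-, e₁, e₂⟩ := add_coord h₁ hT (by rwa [ha])
    rw [e₁, ha, hb] at e₂
    rw [ha, hb] at e₁
    refine ⟨hd, ?_, ?_⟩
    · rw [e₁]; field_simp; ring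
    · rw [e₂]; field_simp; ring
  refine ⟨?_, ?_, ?_⟩
  · have v := ((vd.pow 2).mul nX).congr (g' := fun Q => (xCoord (Q + T))⁻¹) (by
      filter_upwards [key] with Q hQ
      rw [hQ.2.1, inv_div, div_eq_mul_inv])
    rwa [zero_pow two_ne_zero, zero_mul] at v
  · have v := ((vd.mul vX).mul nY).congr (g' := fun Q => xCoord (Q + T) / yCoord (Q + T)) (by
      filter_upwards [key] with Q hQ
      rw [hQ.2.1, hQ.2.2, div_div_div_eq, div_eq_mul_inv, mul_inv]
      have := hQ.1
      field_simp)
    rwa [zero_mul, zero_mul] at v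
  · have v := ((vd.pow 3).mul nY).congr (g' := fun Q => 1 / yCoord (Q + T)) (by
      filter_upwards [key] with Q hQ
      rw [hQ.2.2, one_div_div, div_eq_mul_inv])
    rwa [zero_pow three_ne_zero, zero_mul] at v

/-- A polynomial in `x / y` and `1 / y` that vanishes at almost all points vanishes at infinity. -/
theorem evalEval_zero_of_eventually [IsAlgClosed K] [(curve A B).IsElliptic] {H : K[X][Y]}
    (hH : ∀ᶠ P : (curve A B).Point in cofinite,
      H.evalEval (xCoord P / yCoord P) (1 / yCoord P) = 0) : H.evalEval 0 0 = 0 := by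
  obtain ⟨T, hT, hy, -⟩ := exists_ne_zero_and_yCoord_ne_zero (A := A) (B := B)
    (p := fun _ => True) (by simp)
  have h : (inl (-yCoord T) : K[ε]) ^ 2 =
      inl (xCoord T) ^ 3 + inl A * inl (xCoord T) + inl B :=
    equation_of (by simpa using coord_equation hT) (by simp)
  obtain ⟨-, v₁, v₂⟩ := hasValue_infinity hT hy
  have e := ((v₁.eval_bivariate v₂ H).congr (g' := fun _ => 0) (by
    filter_upwards [(add_left_injective T).tendsto_cofinite.eventually hH] with Q hQ
      using hQ.symm)).unique h (hasValue_const 0)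
  have := congrArg fst e
  rwa [fst_aevalAeval] at this

end Infinity

/-! ### The pole at infinity and the uniqueness of the linear term -/

section LinearTerm

variable {K : Type*} [Field K] [IsAlgClosed K] [DecidableEq K] {A₁ B₁ A₂ B₂ : K}
  [(curve A₁ B₁).IsElliptic]
  {φ : (curve A₁ B₁).Point →+ (curve A₂ B₂).Point} {r s : RatFunc K}

/-- If both `m` and `m'` are linear terms, then `m - m'` is a multiple of `x / y` by a function that
is regular at infinity. -/
theorem HasLinearTerm.unique {m m' : K} (h : HasLinearTerm φ m) (h' : HasLinearTerm φ m') :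
    m = m' := by
  obtain ⟨F, G, hG, h⟩ := h
  obtain ⟨F', G', hG', h'⟩ := h'
  have h := generically_iff.mp h
  have h' := generically_iff.mp h'
  have e := evalEval_zero_of_eventually (A := A₁) (B := B₁)
    (H := CC (m - m') * G * G' - C X * (F * G' - F' * G)) (by
      filter_upwards [h, h', tendsto_xCoord.eventually
        ((Set.finite_singleton (0 : K)).compl_mem_cofinite)] with P hP hP' hx
      obtain ⟨-, hy, -, k, e⟩ := hP
      obtain ⟨-, -, -, k', e'⟩ := hP'
      rw [e] at e'
      have hu : xCoord P / yCoord P ≠ 0 := div_ne_zero hx hy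
      simp only [evalEval_sub, evalEval_mul, evalEval_C, eval_X, eval_C]
      rw [neg_div] at e'
      generalize xCoord P / yCoord P = u at *
      generalize 1 / yCoord P = v at *
      generalize F.evalEval u v = a at *
      generalize G.evalEval u v = b at *
      generalize F'.evalEval u v = a' at *
      generalize G'.evalEval u v = b' at *
      field_simp at e'
      apply mul_left_cancel₀ hu
      linear_combination -u * e')
  simp only [evalEval_sub, evalEval_mul, evalEval_C, eval_X, eval_C, zero_mul,
    sub_zero] at e
  simpa [hG, hG', sub_eq_zero] using e

/-- The rational function `r` has a pole at infinity. Otherwise `x(φ(Q + T))` would be regular at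
`Q = -T`, while `φ(Q + T) = φ Q + φ T` tends to infinity there. -/
theorem HasStandardForm.natDegree_lt (hφ : HasStandardForm φ r s) :
    r.denom.natDegree < r.num.natDegree := by
  by_contra! hdeg
  have hf := hasStandardForm_iff.mp hφ
  obtain ⟨T, hT, hy, hφT, hφy⟩ := exists_ne_zero_and_yCoord_ne_zero
    (hf.and (hφ.tendsto.eventually eventually_yCoord_ne))
  obtain ⟨k₀, k₁, -, k₃, k₄⟩ := hφT
  have h : (inl (-yCoord T) : K[ε]) ^ 2 =
      inl (xCoord T) ^ 3 + inl A₁ * inl (xCoord T) + inl B₁ :=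
    equation_of (by simpa using coord_equation hT) (by simp)
  obtain ⟨vz, -, -⟩ := hasValue_infinity hT hy
  have hV : (aeval (0 : K[ε]) (reflect r.denom.natDegree r.denom)).fst ≠ 0 := by
    rw [fst_aeval, fst_zero, ← coeff_zero_eq_eval_zero, coeff_reflect, revAt_zero]
    exact leadingCoeff_ne_zero.mpr r.denom_ne_zero
  -- In terms of `z = 1 / x`, the denominator of `r` takes its leading coefficient at `0`.
  have vg := ((vz.eval_polynomial (reflect r.denom.natDegree r.num)).mul
    ((vz.eval_polynomial (reflect r.denom.natDegree r.denom)).inv h hV)).congr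
    (g' := fun Q => xCoord (φ (Q + T))) (by
      have ht := (add_left_injective T).tendsto_cofinite
      filter_upwards [ht.eventually hf, ht.eventually (tendsto_xCoord.eventually
        ((Set.finite_singleton (0 : K)).compl_mem_cofinite))] with Q hQ hx
      rw [hQ.2.2.2.1]
      generalize xCoord (Q + T) = x at *
      have hx : x ≠ 0 := hx
      let _ := invertibleOfNonzero hx
      have e₁ := eval₂_reflect_mul_pow (RingHom.id K) x _ r.num hdeg
      have e₂ := eval₂_reflect_mul_pow (RingHom.id K) x _ r.denom le_rfl
      simp only [eval₂_id, _root_.invOf_eq_inv] at e₁ e₂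
      simp only [RatFunc.eval, eval₂_id]
      rw [← e₁, ← e₂, mul_div_mul_right _ _ (pow_ne_zero _ hx), div_eq_mul_inv])
  have vφ : HasPointValue _ _ φ _ _ := (hasPointValue_id (A₁ := A₁) (B₁ := B₁)
    (x := inl (xCoord T)) (y := inl (-yCoord T))).comp_standardForm hφ h tendsto_id
      (by simpa using k₁)
  have hne : ∀ᶠ Q in cofinite, xCoord (φ Q) ≠ xCoord (φ T) :=
    hφ.tendsto.eventually (tendsto_xCoord.eventually
      ((Set.finite_singleton (xCoord (φ T))).compl_mem_cofinite))
  have vd := vφ.x_value.sub (hasValue_const (xCoord (φ T)))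
  have vn := vφ.y_value.sub (hasValue_const (yCoord (φ T)))
  -- Evaluate `(x(φ Q) - x(φ T))² (x(φ(Q + T)) + x(φ Q) + x(φ T)) = (y(φ Q) - y(φ T))²` at `Q = -T`.
  have e := (((vd.pow 2).mul ((vg.add vφ.x_value).add (hasValue_const (xCoord (φ T))))).congr
    (g' := fun Q => (yCoord (φ Q) - yCoord (φ T)) ^ 2) (by
      filter_upwards [vφ.ne_zero, hne] with Q h₁ h₂
      obtain ⟨-, e, -⟩ := add_coord h₁ k₀ h₂
      rw [map_add, e]
      have := sub_ne_zero.mpr h₂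
      field_simp
      ring)).unique h (vn.pow 2)
  have e' := congrArg fst e
  simp only [fst_mul, fst_pow, fst_sub, fst_inl, fst_ratEval, ← k₃] at e'
  have k₄' : -yCoord T * s.eval (RingHom.id K) (xCoord T) = -yCoord (φ T) := by
    rw [k₄]; ring
  rw [k₄'] at e'
  have two := (disc_ne (A := A₁) (B := B₁)).1
  have : (2 * yCoord (φ T)) ^ 2 = 0 := by linear_combination -e'
  exact mul_ne_zero two hφy (pow_eq_zero_iff two_ne_zero |>.mp this)

end LinearTerm

/-! ### Degrees at infinity -/

section Degrees

variable {K : Type*} [Field K]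

theorem natDegree_X_mul_derivative_le (q : K[X]) : (X * derivative q).natDegree ≤ q.natDegree := by
  rw [natDegree_le_iff_coeff_eq_zero]
  intro N hN
  rcases N with _ | n
  · exact absurd hN (Nat.not_lt_zero _)
  · rw [coeff_X_mul, coeff_derivative, coeff_eq_zero_of_natDegree_lt hN, zero_mul]

/-- A polynomial form of the statement that `r / s - m x` is finite at infinity if `r = u / v` and
`s = a / b` satisfy `(x³ + A₁ x + B₁) s² = r³ + A₂ r + B₂` and `m s = r'`, and `r` has a pole at
infinity. If its order is `1`, then `r / r' = x + O(1)`. If the order is larger, then it is at least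
`3`, so that `r / s` is finite, and the order of `r'` forces `m = 0`. -/
theorem natDegree_linear_term_le {A₁ B₁ A₂ B₂ m : K} {u v a b : K[X]} (hv : v.Monic) (ha : a ≠ 0)
    (hb : b ≠ 0) (huv : v.natDegree < u.natDegree)
    (h₁ : (X ^ 3 + C A₁ * X + C B₁) * (a ^ 2 * v ^ 3) =
      b ^ 2 * (u ^ 3 + C A₂ * u * v ^ 2 + C B₂ * v ^ 3))
    (h₂ : C m * (a * v ^ 2) = b * (derivative u * v - u * derivative v)) :
    (u * b - C m * X * a * v).natDegree ≤ (v * a).natDegree := by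
  have hv0 := hv.ne_zero
  have hu0 : u ≠ 0 := by rintro rfl; simp at huv
  have hf : (X ^ 3 + C A₁ * X + C B₁ : K[X]).natDegree = 3 := by compute_degree!
  have hf0 : (X ^ 3 + C A₁ * X + C B₁ : K[X]) ≠ 0 := by
    intro h0; rw [h0] at hf; simp at hf
  have hC : ∀ (c : K) (q : K[X]), (C c * q).natDegree ≤ q.natDegree := natDegree_C_mul_le
  have hg : (u ^ 3 + C A₂ * u * v ^ 2 + C B₂ * v ^ 3).natDegree = 3 * u.natDegree := by
    have e₁ : (C A₂ * u * v ^ 2).natDegree ≤ u.natDegree + 2 * v.natDegree := by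
      rw [← natDegree_pow]
      exact natDegree_mul_le.trans (Nat.add_le_add_right (hC _ _) _)
    have e₂ : (C B₂ * v ^ 3).natDegree ≤ 3 * v.natDegree := by
      rw [← natDegree_pow]; exact hC _ _
    have e₃ : (u ^ 3).natDegree = 3 * u.natDegree := natDegree_pow _ _
    rw [natDegree_add_eq_left_of_natDegree_lt, natDegree_add_eq_left_of_natDegree_lt, e₃]
    · omega
    · rw [natDegree_add_eq_left_of_natDegree_lt] <;> omega
  have hg0 : (u ^ 3 + C A₂ * u * v ^ 2 + C B₂ * v ^ 3) ≠ 0 := by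
    intro h0; rw [h0, natDegree_zero] at hg; omega
  have d₁ : 3 + (2 * a.natDegree + 3 * v.natDegree) = 2 * b.natDegree + 3 * u.natDegree := by
    have := congrArg natDegree h₁
    rwa [natDegree_mul hf0 (mul_ne_zero (pow_ne_zero 2 ha) (pow_ne_zero 3 hv0)),
      natDegree_mul (pow_ne_zero 2 ha) (pow_ne_zero 3 hv0),
      natDegree_mul (pow_ne_zero 2 hb) hg0, hg, hf, natDegree_pow, natDegree_pow,
      natDegree_pow] at this
  rw [natDegree_mul hv0 ha]
  rcases Nat.lt_or_ge (v.natDegree + 1) u.natDegree with hlt | hge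
  · have hm : m = 0 := by
      by_contra hm
      have hW : X * (derivative u * v - u * derivative v) =
          X * derivative u * v - u * (X * derivative v) := by ring
      have hL : C m * (a * v ^ 2) ≠ 0 :=
        mul_ne_zero (C_ne_zero.mpr hm) (mul_ne_zero ha (pow_ne_zero 2 hv0))
      have hW0 : derivative u * v - u * derivative v ≠ 0 := by
        intro h0; rw [h0, mul_zero] at h₂; exact hL h₂
      have dW : 1 + (derivative u * v - u * derivative v).natDegree ≤
          u.natDegree + v.natDegree := by
        rw [← natDegree_X (R := K), ← natDegree_mul X_ne_zero hW0, hW]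
        refine (natDegree_sub_le _ _).trans (max_le
          (natDegree_mul_le.trans (Nat.add_le_add_right (natDegree_X_mul_derivative_le u) _))
          (natDegree_mul_le.trans (Nat.add_le_add_left (natDegree_X_mul_derivative_le v) _)))
      have d₂ := congrArg natDegree h₂
      rw [natDegree_C_mul hm, natDegree_mul ha (pow_ne_zero 2 hv0), natDegree_pow,
        natDegree_mul hb hW0] at d₂
      omega
    rw [hm, map_zero, zero_mul, zero_mul, zero_mul, sub_zero, natDegree_mul hu0 hb]
    omega
  · have hu : u.natDegree = v.natDegree + 1 := by omega
    -- Write `u = c x v + q`; the contributions of `c x v` to `u v` and `x (u' v - u v')` cancel.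
    obtain ⟨q, hq, e⟩ : ∃ q : K[X], q.natDegree ≤ v.natDegree ∧
        u = C u.leadingCoeff * (X * v) + q := by
      refine ⟨u - C u.leadingCoeff * (X * v), ?_, by ring⟩
      rw [natDegree_le_iff_coeff_eq_zero]
      intro N hN
      obtain ⟨n, rfl⟩ : ∃ n, N = n + 1 := ⟨N - 1, by omega⟩
      rw [coeff_sub, coeff_C_mul, coeff_X_mul]
      rcases Nat.eq_or_lt_of_le (Nat.le_of_lt_succ hN) with hn | hn
      · rw [← hn, ← hu, coeff_natDegree, hv.coeff_natDegree, mul_one, sub_self]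
      · rw [coeff_eq_zero_of_natDegree_lt hn, coeff_eq_zero_of_natDegree_lt (by omega), mul_zero,
          sub_zero]
    generalize u.leadingCoeff = c at e
    have e' : (u * b - C m * X * a * v) * v =
        b * (q * v - (X * derivative q) * v + q * (X * derivative v)) := by
      rw [e] at h₂ ⊢
      simp only [derivative_add, derivative_mul, derivative_C, derivative_X] at h₂
      linear_combination -X * h₂
    have hR : (q * v - (X * derivative q) * v + q * (X * derivative v)).natDegree ≤
        v.natDegree + v.natDegree :=
      (natDegree_add_le _ _).trans (max_le ((natDegree_sub_le _ _).trans (max_le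
        (natDegree_mul_le.trans (Nat.add_le_add_right hq _))
        (natDegree_mul_le.trans
          (Nat.add_le_add_right ((natDegree_X_mul_derivative_le q).trans hq) _))))
        (natDegree_mul_le.trans (Nat.add_le_add hq (natDegree_X_mul_derivative_le v))))
    by_cases h0 : u * b - C m * X * a * v = 0
    · rw [h0, natDegree_zero]; exact Nat.zero_le _
    · have d := congrArg natDegree e'
      rw [natDegree_mul h0 hv0] at d
      have := natDegree_mul_le (p := b)
        (q := q * v - (X * derivative q) * v + q * (X * derivative v))
      omega

end Degrees

/-! ### The existence of the linear term -/

section LinearTerm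

variable {K : Type*} [Field K]

/-- The polynomial `x³ / y²` in the coordinates `x / y`, `1 / y` at infinity. -/
noncomputable def cubeDivSq (A B : K) : K[X][Y] := 1 - CC A * C X * Y - CC B * Y ^ 2

/-- The polynomial `(x / y)^(2 D) q(x)` in the coordinates `x / y`, `1 / y` at infinity, for a
polynomial `q` of degree at most `D`; here `x = (x³ / y²) / (x / y)²`. -/
noncomputable def homogenize (A B : K) (D : ℕ) (q : K[X]) : K[X][Y] :=
  ∑ i ∈ Finset.range (D + 1), CC (q.coeff i) * cubeDivSq A B ^ i * C X ^ (2 * (D - i))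

theorem evalEval_cubeDivSq {A B x y : K} (hy : y ≠ 0) (h : y ^ 2 = x ^ 3 + A * x + B) :
    (cubeDivSq A B).evalEval (x / y) (1 / y) = x ^ 3 / y ^ 2 := by
  simp only [cubeDivSq, evalEval_sub, evalEval_mul, evalEval_pow, evalEval_one, evalEval_C,
    eval_C, eval_X, evalEval_X]
  field_simp
  linear_combination h

theorem evalEval_homogenize {A B x y : K} (hx : x ≠ 0) (hy : y ≠ 0)
    (h : y ^ 2 = x ^ 3 + A * x + B) {D : ℕ} {q : K[X]} (hq : q.natDegree ≤ D) :
    (homogenize A B D q).evalEval (x / y) (1 / y) = (x / y) ^ (2 * D) * q.eval x := by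
  rw [homogenize, evalEval_finsetSum, eval_eq_sum_range' (Nat.lt_succ_of_le hq), Finset.mul_sum]
  refine Finset.sum_congr rfl fun i hi => ?_
  have hi : i ≤ D := Nat.le_of_lt_succ (Finset.mem_range.mp hi)
  simp only [evalEval_mul, evalEval_pow, evalEval_C, eval_C, eval_X, evalEval_cubeDivSq hy h]
  have e : x ^ 3 / y ^ 2 = (x / y) ^ 2 * x := by field_simp
  rw [e, mul_pow, ← pow_mul]
  have : (x / y) ^ (2 * D) = (x / y) ^ (2 * i) * (x / y) ^ (2 * (D - i)) := by
    rw [← pow_add]; congr 1; omega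
  rw [this]
  ring

theorem evalEval_zero_cubeDivSq (A B : K) : (cubeDivSq A B).evalEval 0 0 = 1 := by
  simp [cubeDivSq]

theorem evalEval_zero_homogenize (A B : K) (D : ℕ) (q : K[X]) :
    (homogenize A B D q).evalEval 0 0 = q.coeff D := by
  rw [homogenize, evalEval_finsetSum, Finset.sum_eq_single D]
  · simp only [evalEval_mul, evalEval_pow, evalEval_C, eval_C, evalEval_zero_cubeDivSq]
    simp
  · intro i hi hne
    have : 2 * (D - i) ≠ 0 := by have := Finset.mem_range.mp hi; omega
    simp [evalEval_mul, evalEval_pow, evalEval_C, this]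
  · intro h; exact absurd (Finset.self_mem_range_succ D) h

variable [IsAlgClosed K] [DecidableEq K] {A₁ B₁ A₂ B₂ : K} [(curve A₁ B₁).IsElliptic]
  {φ : (curve A₁ B₁).Point →+ (curve A₂ B₂).Point} {r s : RatFunc K}

/-- The multiplier of the invariant differential is the coefficient of the linear term at
infinity. -/
theorem HasStandardForm.hasLinearTerm [(curve A₂ B₂).IsElliptic] (hφ : HasStandardForm φ r s)
    {m : K} (hm : s * RatFunc.C m = ratDeriv r) : HasLinearTerm φ m := by
  have hv0 := r.denom_ne_zero
  have hb0 := s.denom_ne_zero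
  have ha0 : s.num ≠ 0 := by
    intro h0
    obtain ⟨q, hq⟩ := hφ.eventually_eval_ne.exists
    simp [RatFunc.eval, h0] at hq
  have h₂ : C m * (s.num * r.denom ^ 2) =
      s.denom * (derivative r.num * r.denom - r.num * derivative r.denom) := by
    have hv' := RatFunc.algebraMap_ne_zero (pow_ne_zero 2 hv0)
    have hb' := RatFunc.algebraMap_ne_zero hb0
    rw [ratDeriv, eq_div_iff hv', ← RatFunc.num_div_denom s, ← RatFunc.algebraMap_C,
      div_mul_eq_mul_div, div_mul_eq_mul_div, div_eq_iff hb',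
      ← map_mul, ← map_mul, ← map_mul] at hm
    have := RatFunc.algebraMap_injective K hm
    linear_combination this
  have hdeg := natDegree_linear_term_le (RatFunc.monic_denom r) ha0 hb0 hφ.natDegree_lt
    hφ.equation h₂
  set n := r.num * s.denom - C m * X * s.num * r.denom with hn
  set d := r.denom * s.num with hd
  refine ⟨-(C X * homogenize A₁ B₁ d.natDegree n),
    cubeDivSq A₁ B₁ * homogenize A₁ B₁ d.natDegree d, ?_, generically_iff.mpr ?_⟩
  · rw [evalEval_mul, evalEval_zero_cubeDivSq, evalEval_zero_homogenize, one_mul,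
      coeff_natDegree, leadingCoeff_ne_zero]
    exact mul_ne_zero hv0 ha0
  · filter_upwards [hasStandardForm_iff.mp hφ, hφ.eventually_eval_ne, eventually_ne_point 0,
      eventually_yCoord_ne, tendsto_xCoord.eventually
        ((Set.finite_singleton (0 : K)).compl_mem_cofinite)] with P hP hs h0 hy hx
    have hx : xCoord P ≠ 0 := hx
    obtain ⟨k₀, k₁, k₂, k₃, k₄⟩ := hP
    have e := coord_equation h0
    have ha : s.num.eval (xCoord P) ≠ 0 := by
      intro ha
      simp [RatFunc.eval, ha] at hs
    have hdP : d.eval (xCoord P) ≠ 0 := by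
      rw [hd, eval_mul]; exact mul_ne_zero k₁ ha
    refine ⟨k₀, hy, by rw [k₄]; exact mul_ne_zero hy hs, ?_, ?_⟩
    · rw [evalEval_mul, evalEval_cubeDivSq hy e, evalEval_homogenize hx hy e le_rfl]
      exact mul_ne_zero (div_ne_zero (pow_ne_zero 3 hx) (pow_ne_zero 2 hy))
        (mul_ne_zero (pow_ne_zero _ (div_ne_zero hx hy)) hdP)
    · rw [evalEval_neg, evalEval_mul, evalEval_mul, evalEval_cubeDivSq hy e,
        evalEval_homogenize hx hy e le_rfl, evalEval_homogenize hx hy e hdeg, evalEval_C, eval_X,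
        k₃, k₄]
      have hu := pow_ne_zero (2 * d.natDegree) (div_ne_zero hx hy)
      generalize (xCoord P / yCoord P) ^ (2 * d.natDegree) = w at *
      simp only [RatFunc.eval, eval₂_id]
      rw [hn, hd]
      simp only [eval_mul, eval_sub, eval_C, eval_X]
      generalize eval (xCoord P) r.denom = v at *
      generalize eval (xCoord P) r.num = u at *
      generalize eval (xCoord P) s.denom = b at *
      generalize eval (xCoord P) s.num = a at *
      field_simp
      ring

end LinearTerm

/-! ### The extension to the lifts -/

section Extension

variable {K : Type*} [Field K] [DecidableEq K] {A₁ B₁ A₂ B₂ : K}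
  [(curve A₁ B₁).IsElliptic] [(curve A₂ B₂).IsElliptic]
  {φ : (curve A₁ B₁).Point →+ (curve A₂ B₂).Point} {r s : RatFunc K} {m : K}

/-- The conditions on an extension determine it: it is `P + O_k ↦ φ P + O_{m k}`. -/
theorem IsExtension.apply_sumPoint (hφ : HasStandardForm φ r s) [Infinite (curve A₁ B₁).Point]
    (he : ∀ p, φ p ≠ 0 → ∀ k, EvaluatesTo r s (sumPoint p k) (sumPoint (φ p) (m * k)))
    {f : LiftPoint A₁ B₁ → LiftPoint A₂ B₂} (hf : IsExtension φ r s m f)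
    (p : (curve A₁ B₁).Point) (k : K) : f (sumPoint p k) = sumPoint (φ p) (m * k) := by
  by_cases h0 : p = 0
  · rw [h0, map_zero, sumPoint_zero, sumPoint_zero, hf.map_inf]
  have hr := reduction_sumPoint p k
  by_cases hp : φ p = 0
  · obtain ⟨T, hT⟩ := (hasStandardForm_iff.mp hφ).exists
    obtain ⟨Q, h₁, h₂⟩ := hf.map_of_mem_ker (sumPoint p k) (by rwa [hr])
      (by rwa [hr, AddMonoidHom.mem_ker]) T (by rw [AddMonoidHom.mem_ker]; exact hT.1)
    have hpT : φ (p + T) ≠ 0 := by rw [map_add, hp, zero_add]; exact hT.1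
    rw [ofCurve_eq_sumPoint, sumPoint_add, add_zero] at h₁
    rw [h₂, h₁.unique (he _ hpT k), ofCurve_eq_sumPoint, sumPoint_add, add_zero, ← map_add,
      add_neg_cancel_right]
  · exact (hf.map_of_not_mem_ker (sumPoint p k) (by rwa [hr])
      (by rwa [hr, AddMonoidHom.mem_ker])).unique (he p hp k)

theorem exists_isExtension
    (he : ∀ p, φ p ≠ 0 → ∀ k, EvaluatesTo r s (sumPoint p k) (sumPoint (φ p) (m * k))) :
    ∃ f : LiftPoint A₁ B₁ → LiftPoint A₂ B₂, IsExtension φ r s m f := by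
  choose p k hpk using sumPoint_surjective (A := A₁) (B := B₁)
  have hf : ∀ q l, sumPoint (φ (p (sumPoint q l))) (m * k (sumPoint q l)) =
      sumPoint (φ q) (m * l) := by
    intro q l
    obtain ⟨h₁, h₂⟩ := sumPoint_injective (hpk (sumPoint q l))
    rw [← h₁, ← h₂]
  refine ⟨fun P => sumPoint (φ (p P)) (m * k P), fun l => ?_, fun P h₀ h₁ => ?_,
    fun P h₀ h₁ T hT => ?_⟩
  · rw [← sumPoint_zero, hf, map_zero, sumPoint_zero]
  · obtain ⟨q, l, rfl⟩ := sumPoint_surjective P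
    rw [reduction_sumPoint, AddMonoidHom.mem_ker] at h₁
    rw [hf]
    exact he q h₁ l
  · obtain ⟨q, l, rfl⟩ := sumPoint_surjective P
    rw [reduction_sumPoint, AddMonoidHom.mem_ker] at h₁
    rw [AddMonoidHom.mem_ker] at hT
    refine ⟨sumPoint (φ (q + T)) (m * l), ?_, ?_⟩
    · rw [ofCurve_eq_sumPoint, sumPoint_add, add_zero]
      exact he _ (by rwa [map_add, h₁, zero_add]) l
    · rw [hf, ofCurve_eq_sumPoint, sumPoint_add, add_zero, ← map_add, add_neg_cancel_right]

end Extension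

end DualEC

theorem mainTheorem5 {K : Type*} [Field K] [IsAlgClosed K] [DecidableEq K]
    (p : ℕ) [CharP K p] (hp₀ : p ≠ 0) (hp₂ : p ≠ 2) (hp₃ : p ≠ 3)
    (A₁ B₁ A₂ B₂ : K) [(curve A₁ B₁).IsElliptic] [(curve A₂ B₂).IsElliptic]
    (φ : (curve A₁ B₁).Point →+ (curve A₂ B₂).Point) (hφ : IsIsogeny φ) :
    (∃! rs : RatFunc K × RatFunc K, HasStandardForm φ rs.1 rs.2) ∧
    (∃! m : K, HasLinearTerm φ m) ∧
    ∀ (r s : RatFunc K) (m : K), HasStandardForm φ r s → HasLinearTerm φ m →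
      s * RatFunc.C m = ratDeriv r ∧
      (∃! f : LiftPoint A₁ B₁ → LiftPoint A₂ B₂, IsExtension φ r s m f) ∧
      ∀ f : LiftPoint A₁ B₁ → LiftPoint A₂ B₂, IsExtension φ r s m f →
        (∀ P, f (ofCurve P) = ofCurve (φ P)) ∧ ∀ P Q, f P + f Q = f (P + Q) := by
  obtain ⟨r₀, s₀, h₀⟩ := exists_hasStandardForm hφ
  obtain ⟨m₀, hm₀, -⟩ := h₀.exists_multiplier
  refine ⟨⟨(r₀, s₀), h₀, fun rs h => ?_⟩,
    ⟨m₀, h₀.hasLinearTerm hm₀, fun m h => h.unique (h₀.hasLinearTerm hm₀)⟩, ?_⟩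
  · obtain ⟨h₁, h₂⟩ := HasStandardForm.unique h h₀
    exact Prod.ext h₁ h₂
  intro r s m hrs hm
  obtain ⟨m', hm', he⟩ := hrs.exists_multiplier
  obtain rfl : m = m' := hm.unique (hrs.hasLinearTerm hm')
  refine ⟨hm', ?_, fun f hf => ⟨fun P => ?_, fun P Q => ?_⟩⟩
  · obtain ⟨f, hf⟩ := exists_isExtension he
    refine ⟨f, hf, fun g hg => funext fun P => ?_⟩
    obtain ⟨q, k, rfl⟩ := sumPoint_surjective P
    rw [hg.apply_sumPoint hrs he, hf.apply_sumPoint hrs he]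
  · rw [ofCurve_eq_sumPoint, hf.apply_sumPoint hrs he, mul_zero, ofCurve_eq_sumPoint]
  · obtain ⟨q, k, rfl⟩ := sumPoint_surjective P
    obtain ⟨q', k', rfl⟩ := sumPoint_surjective Q
    rw [sumPoint_add, hf.apply_sumPoint hrs he, hf.apply_sumPoint hrs he,
      hf.apply_sumPoint hrs he, sumPoint_add, map_add, mul_add]
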